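/- **Setting.** Let $Z_1,Z_2,\dots$ be i.i.d. For each $n$ let $I_1,\dots,I_{s}$ ($s=s_n$) be disjoint subsets of $\{1,\dots,n\}$, each of size $b=b_n\ge 1$, possibly chosen at random but independently of the data. In every subset the same (measurable) fitting procedure is run once on $\{Z_i:i\in I_k\}$ and returns per-unit contributions $\hat\theta_{i,k}$, $i\in I_k$. Put $$\hat\theta_k=\frac1b\sum_{i\in I_k}\hat\theta_{i,k},\qquad \sigma_k^2=\frac1b\sum_{i\in I_k}(\hat\theta_{i,k}-\hat\theta_k)^2 .$$ With the contributions frozen, draw count vectors $M^{(k,\ell)}=(M^{(k,\ell)}_i)_{i\in I_k}\sim\mathrm{Multinomial}(n;1/b,\dots,1/b)$, independent over the subsets $k$ and the replicates $\ell$ and independent of the data and the partition, and form the replicates $\hat\theta^{*}_{k,\ell}=\frac1n\sum_{i\in I_k}M^{(k,\ell)}_i\hat\theta_{i,k}$. For $r=r_n$ replicates let $\bar Q_p$ be the average over the $s$ subsets of the empirical $p$-quantile $\inf\{t:\#\{\ell\le r:\hat\theta^*_{k,\ell}\le t\}\ge pr\}$. **Assumptions.** (i) The full-sample estimator $\hat\theta_n$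 satisfies $\sqrt n(\hat\theta_n-\theta_0)=n^{-1/2}\sum_{i\le n}\psi(Z_i)+o_p(1)$, where $E\,\psi(Z)=0$ and $E\,\psi(Z)^2<\infty$. (ii) Within a subset, $\hat\theta_{i,k}=\theta_0+\psi(Z_i)+r_{i,k}$ with $b^{-1/2}\sum_{i\in I_k}r_{i,k}=o_p(1)$ and $b^{-1}\sum_{i\in I_k}r_{i,k}^2=o_p(1)$. (The laws of these two quantities do not depend on $k$.) (iii) $b\to\infty$, $b/n\to0$ and $n-sb=o(n)$. **Theorem.** Write $V=\operatorname{Var}\psi(Z)$. 1. Conditionally on $\{Z_i:i\in I_k\}$, $\sqrt n(\hat\theta^*_{k,\ell}-\hat\theta_k)$ is asymptotically $N(0,\sigma_k^2)$: the Lévy–Prokhorov distance between its conditional distribution and $N(0,\sigma_k^2)$ tends to $0$ in probability (uniformly over $k$, for every $\ell$). 2. For every $\varepsilon>0$, $\frac1s\sum_{k=1}^s\mathbf 1\{|\sigma_k^2-V|>\varepsilon\}\to0$ in probability. If moreover $\frac1s\sum_{k=1}^s\frac1b\sum_{i\in I_k}r_{i,k}^2=o_p(1)$, then $\frac1s\sum_{k=1}^s\sigma_k^2\to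 V$ in probability. 3. Suppose $V>0$ and write $q_p$ for the $p$-quantile of $N(0,V)$. If $r\to\infty$, $\frac1s\sum_{k}\frac1b\sum_{i\in I_k}r_{i,k}^2=o_p(1)$ and $\sqrt n\bigl(\frac1s\sum_k\hat\theta_k-\hat\theta_n\bigr)=o_p(1)$, then the averaged bootstrap quantiles target the quantiles of the limiting distribution: $\sqrt n(\bar Q_p-\hat\theta_n)\to q_p$ in probability for every $p\in(0,1)$. 4. Suppose $V>0$ and $0<\alpha<1$. Whenever $\sqrt n(\bar Q_p-\hat\theta_n)\to q_p$ in probability for $p=\alpha/2$ and $p=1-\alpha/2$ (in particular under the conditions of part 3), the averaged percentile interval has asymptotically correct coverage: $P\bigl(\bar Q_{\alpha/2}<\theta_0<\bar Q_{1-\alpha/2}\bigr)\to1-\alpha$. -/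

import Mathlib

open MeasureTheory ProbabilityTheory Filter Topology
open scoped ENNReal NNReal

noncomputable section

namespace CBLB

/-- The multinomial law with `n` trials and cell probabilities `p`, on count vectors `ι → ℕ`:
the vector `m` with `∑ m = n` has mass `n! / ∏ (m a)! * ∏ (p a) ^ (m a)`. -/
def multinomialLaw {ι : Type*} [Fintype ι] [DecidableEq ι] (n : ℕ) (p : ι → ℝ≥0∞) :
    Measure (ι → ℕ) :=
  ∑ m ∈ Finset.piAntidiag (Finset.univ : Finset ι) n,
    ((Nat.multinomial Finset.univ m : ℝ≥0∞) * ∏ a, p a ^ m a) • Measure.dirac m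

/-- The mean of a finite list of contributions. -/
def empMean {b : ℕ} (x : Fin b → ℝ) : ℝ := (∑ a, x a) / b

/-- The variance of a finite list of contributions under its empirical distribution. -/
def empVar {b : ℕ} (x : Fin b → ℝ) : ℝ := (∑ a, (x a - empMean x) ^ 2) / b

/-- The reweighted mean `(1/n) ∑ M_a x_a` of frozen contributions `x` with counts `m`. -/
def reweightedMean {b : ℕ} (n : ℕ) (m : Fin b → ℕ) (x : Fin b → ℝ) : ℝ :=
  (∑ a, (m a : ℝ) * x a) / n

/-- The empirical `p`-quantile of `y`: the generalised inverse at `p` of the empirical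
distribution function, `inf {t | #{ℓ | y ℓ ≤ t} / r ≥ p}`. -/
def empQuantile (p : ℝ) {r : ℕ} (y : Fin r → ℝ) : ℝ :=
  sInf {t : ℝ | p * r ≤ (Finset.univ.filter fun l => y l ≤ t).card}

/-- Convergence to zero in probability for quantities attached to the subsets of a growing
partition, whichever subset is looked at in each partition. -/
def SubsetLittleOp {Ω : Type*} [MeasurableSpace Ω] (μ : Measure Ω) (s : ℕ → ℕ)
    (X : (n : ℕ) → Fin (s n) → Ω → ℝ) : Prop :=
  ∀ ε : ℝ, 0 < ε → Tendsto (fun n => ⨆ k : Fin (s n), μ {ω | ε ≤ |X n k ω|}) atTop (𝓝 0)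

section Setup

variable {Ω 𝒵 : Type*} {s b : ℕ → ℕ}

/-- The data `(Z_i)_{i ∈ I_k}` of subset `k`, listed in the order of the block. -/
def subsetData (Z : ℕ → Ω → 𝒵) (I : (n : ℕ) → Ω → Fin (s n) → Fin (b n) → Fin n)
    (n : ℕ) (k : Fin (s n)) (ω : Ω) : Fin (b n) → 𝒵 :=
  fun a => Z (I n ω k a) ω

/-- The frozen per-unit contributions of subset `k`: the fitting procedure applied to the data
of the subset. -/
def contrib (Z : ℕ → Ω → 𝒵) (I : (n : ℕ) → Ω → Fin (s n) → Fin (b n) → Fin n)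
    (fit : (n : ℕ) → (Fin (b n) → 𝒵) → Fin (b n) → ℝ)
    (n : ℕ) (k : Fin (s n)) (ω : Ω) : Fin (b n) → ℝ :=
  fit n (subsetData Z I n k ω)

/-- The remainders `r_{i,k} = θ̂_{i,k} - θ₀ - ψ(Z_i)`. -/
def remainder (Z : ℕ → Ω → 𝒵) (I : (n : ℕ) → Ω → Fin (s n) → Fin (b n) → Fin n)
    (fit : (n : ℕ) → (Fin (b n) → 𝒵) → Fin (b n) → ℝ) (θ₀ : ℝ) (ψ : 𝒵 → ℝ)
    (n : ℕ) (k : Fin (s n)) (ω : Ω) (a : Fin (b n)) : ℝ :=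
  contrib Z I fit n k ω a - θ₀ - ψ (subsetData Z I n k ω a)

/-- The `l`-th bootstrap replicate in subset `k`. -/
def bootReplicate (Z : ℕ → Ω → 𝒵) (I : (n : ℕ) → Ω → Fin (s n) → Fin (b n) → Fin n)
    (fit : (n : ℕ) → (Fin (b n) → 𝒵) → Fin (b n) → ℝ)
    (M : (n : ℕ) → Fin (s n) → ℕ → Ω → Fin (b n) → ℕ)
    (n : ℕ) (k : Fin (s n)) (l : ℕ) (ω : Ω) : ℝ :=
  reweightedMean n (M n k l ω) (contrib Z I fit n k ω)

/-- The average over the subsets of the empirical `p`-quantiles of the first `r n` replicates;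
the cBLB percentile interval has these averages as its end points. -/
def avgQuantile (Z : ℕ → Ω → 𝒵) (I : (n : ℕ) → Ω → Fin (s n) → Fin (b n) → Fin n)
    (fit : (n : ℕ) → (Fin (b n) → 𝒵) → Fin (b n) → ℝ)
    (M : (n : ℕ) → Fin (s n) → ℕ → Ω → Fin (b n) → ℕ) (r : ℕ → ℕ) (p : ℝ)
    (n : ℕ) (ω : Ω) : ℝ :=
  (∑ k : Fin (s n),
    empQuantile p fun l : Fin (r n) => bootReplicate Z I fit M n k l ω) / s n

/-- The averaged `p`-quantile targets the `p`-quantile `q` of the limit law `N(0, v)`: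
`√n (Q̄_p - θ̂_n) → q` in probability, with `θ̂_n` the full-sample estimator. -/
def QuantileTargets [MeasurableSpace Ω] (μ : Measure Ω) (Z : ℕ → Ω → 𝒵)
    (I : (n : ℕ) → Ω → Fin (s n) → Fin (b n) → Fin n)
    (fit : (n : ℕ) → (Fin (b n) → 𝒵) → Fin (b n) → ℝ)
    (M : (n : ℕ) → Fin (s n) → ℕ → Ω → Fin (b n) → ℕ) (r : ℕ → ℕ)
    (full : (n : ℕ) → (Fin n → 𝒵) → ℝ) (v : ℝ) (p : ℝ) : Prop :=
  ∀ q : ℝ, cdf (gaussianReal 0 v.toNNReal) q = p →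
    TendstoInMeasure μ
      (fun (n : ℕ) ω => √(n : ℝ) * (avgQuantile Z I fit M r p n ω - full n fun i => Z i ω))
      atTop (fun _ => q)

end Setup

end CBLB

end

/-!
Conditionally on the data of a subset, a replicate is a reweighted mean of fixed numbers
`x₁, …, x_b` with uniform multinomial weights. By the multinomial theorem the characteristic function
of the centred and scaled replicate is an `n`-th power, so the replicate is distributed as a
normalized sum of `n` independent draws from the empirical law of the centred `x_a`.

*Normality.* `exists_forall_levyProkhorovDist_bootLaw_lt` is a central limit theorem for these
sums that is uniform over all lists `x` whose empirical variance is close to a given value and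
whose part of that variance beyond the level `δ √n` is small; it follows from the Lindeberg
estimate of the characteristic function, Lévy's continuity theorem and the metrization of weak
convergence by the Lévy–Prokhorov distance. Every subset of the sample is itself an i.i.d. sample
of size `b`, whatever the subset looked at. Hence, by the weak law of large numbers for `ψ` and
`ψ²` and by Markov's inequality for the truncated squares, the contributions satisfy these
conditions outside an event whose probability vanishes uniformly over the subsets
(`unifNull_contrib_notMem_cltSet`). The part due to the remainders is absorbed by their mean
square.

*Averages of the variances.* A quantity that is bounded and uniformly negligible over the subsets
is negligible on average over them, because its expected average is small. The average of the
`σ_k²` themselves differs from that of the variances of the influence values by a term which the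
average of the mean squared remainders controls.

*Quantiles.* Given the data, the empirical distribution function of `r → ∞` replicates is close to
that of `N(0, V)` at each fixed point, by Chebyshev's inequality, and this pins the empirical
`p`-quantile of the recentred and scaled replicates near `q_p` (`unifNull_rootQuantile`). To pass to
the average over the subsets, the contribution of the exceptional subsets has to be negligible. The
square of this quantile is at most a constant multiple of the mean square of the recentred and
scaled replicates, whose conditional mean is `σ_k²`. Since the average of the `σ_k²` is bounded
in probability, so is the average of the squared quantiles, and by Young's inequality the few
exceptional subsets are negligible.

*Coverage.* By the central limit theorem for `n^{-1/2} ∑ ψ(Z_i)` and Slutsky's argument, the event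
that the interval covers `θ₀` is asymptotically the event that `N(0, V)` lies between `-q_{1-α/2}`
and `-q_{α/2}`, of probability `1 - α` by symmetry. The argument works with outer measures, since
the full-sample estimator need not be measurable.
-/

namespace CBLB

/-! ### Empirical moments of finite lists -/

/-- The contribution to the empirical variance of a finite list that comes from the entries
further than `c` from the mean: the quantity of Lindeberg's condition. -/
noncomputable def lindTail {b : ℕ} (x : Fin b → ℝ) (c : ℝ) : ℝ :=
  (∑ a, if c < |x a - empMean x| then (x a - empMean x) ^ 2 else 0) / b

lemma sum_sub_empMean {b : ℕ} (hb : 0 < b) (x : Fin b → ℝ) : ∑ a, (x a - empMean x) = 0 := by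
  have : (b : ℝ) ≠ 0 := by positivity
  rw [Finset.sum_sub_distrib, Finset.sum_const, Finset.card_univ, Fintype.card_fin, nsmul_eq_mul,
    empMean]
  field_simp
  ring

lemma empMean_add {b : ℕ} (x y : Fin b → ℝ) :
    empMean (fun a => x a + y a) = empMean x + empMean y := by
  simp only [empMean, Finset.sum_add_distrib, add_div]

lemma empMean_const_add {b : ℕ} (hb : 0 < b) (c : ℝ) (x : Fin b → ℝ) :
    empMean (fun a => c + x a) = c + empMean x := by
  have : (b : ℝ) ≠ 0 := by positivity
  rw [empMean_add]
  simp [empMean, this]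

lemma empVar_nonneg {b : ℕ} (x : Fin b → ℝ) : 0 ≤ empVar x := by
  unfold empVar; positivity

lemma empVar_const_add {b : ℕ} (hb : 0 < b) (c : ℝ) (x : Fin b → ℝ) :
    empVar (fun a => c + x a) = empVar x := by
  simp only [empVar, empMean_const_add hb, add_sub_add_left_eq_sub]

lemma lindTail_const_add {b : ℕ} (hb : 0 < b) (c : ℝ) (x : Fin b → ℝ) (t : ℝ) :
    lindTail (fun a => c + x a) t = lindTail x t := by
  simp only [lindTail, empMean_const_add hb, add_sub_add_left_eq_sub]

lemma empVar_eq {b : ℕ} (hb : 0 < b) (x : Fin b → ℝ) :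
    empVar x = (∑ a, x a ^ 2) / b - empMean x ^ 2 := by
  have hb' : (b : ℝ) ≠ 0 := by positivity
  have h : ∑ a, x a = b * empMean x := by rw [empMean]; field_simp
  have h2 : ∑ a, (x a - empMean x) ^ 2
      = ∑ a, x a ^ 2 - 2 * empMean x * ∑ a, x a + b * empMean x ^ 2 := by
    simp only [sub_sq, Finset.sum_add_distrib, Finset.sum_sub_distrib, Finset.sum_const,
      Finset.card_univ, Fintype.card_fin, nsmul_eq_mul, Finset.mul_sum]
    congr 2
    exact Finset.sum_congr rfl fun a _ => by ring
  rw [empVar, h2, h]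
  field_simp
  ring

lemma empMean_sq_le {b : ℕ} (hb : 0 < b) (x : Fin b → ℝ) :
    empMean x ^ 2 ≤ (∑ a, x a ^ 2) / b := by
  have := empVar_eq hb x
  have := empVar_nonneg x
  linarith

/-- Perturbation of the empirical variance. The parameter `η` comes from Young's inequality
`2 w r ≤ η w² + r² / η`. -/
lemma abs_empVar_add_sub_le {b : ℕ} (hb : 0 < b) (w r : Fin b → ℝ) {η : ℝ} (hη : 0 < η) :
    |empVar (fun a => w a + r a) - (∑ a, w a ^ 2) / b|
      ≤ η * ((∑ a, w a ^ 2) / b) + (3 + η⁻¹) * ((∑ a, r a ^ 2) / b) + 2 * empMean w ^ 2 := by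
  have hb' : (0 : ℝ) < b := by positivity
  have h1 : (∑ a, (w a + r a) ^ 2) / b
      = (∑ a, w a ^ 2) / b + (∑ a, 2 * (w a * r a)) / b + (∑ a, r a ^ 2) / b := by
    rw [← add_div, ← add_div, ← Finset.sum_add_distrib, ← Finset.sum_add_distrib]
    congr 1
    exact Finset.sum_congr rfl fun a _ => by ring
  have h2 : |(∑ a, 2 * (w a * r a)) / b|
      ≤ η * ((∑ a, w a ^ 2) / b) + η⁻¹ * ((∑ a, r a ^ 2) / b) := by
    rw [abs_div, abs_of_pos hb', ← mul_div_assoc, ← mul_div_assoc, ← add_div, Finset.mul_sum,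
      Finset.mul_sum, ← Finset.sum_add_distrib]
    refine div_le_div_of_nonneg_right ((Finset.abs_sum_le_sum_abs _ _).trans
      (Finset.sum_le_sum fun a _ => ?_)) hb'.le
    have e : η * w a ^ 2 + η⁻¹ * r a ^ 2 - 2 * (w a * r a) = η⁻¹ * (η * w a - r a) ^ 2 := by
      field_simp; ring
    have e' : η * w a ^ 2 + η⁻¹ * r a ^ 2 + 2 * (w a * r a) = η⁻¹ * (η * w a + r a) ^ 2 := by
      field_simp; ring
    have p1 : 0 ≤ η⁻¹ * (η * w a - r a) ^ 2 := by positivity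
    have p2 : 0 ≤ η⁻¹ * (η * w a + r a) ^ 2 := by positivity
    rw [abs_le]; constructor <;> linarith
  have h3 := empMean_sq_le hb r
  have h4 : (empMean w + empMean r) ^ 2 ≤ 2 * empMean w ^ 2 + 2 * empMean r ^ 2 := by
    nlinarith [sq_nonneg (empMean w - empMean r)]
  have h5 : 0 ≤ (∑ a, r a ^ 2) / b := by positivity
  rw [empVar_eq hb, empMean_add, h1]
  obtain ⟨h2a, h2b⟩ := abs_le.1 h2
  have h6 := sq_nonneg (empMean w + empMean r)
  have h7 := sq_nonneg (empMean w)
  rw [abs_le]; constructor <;> nlinarith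

lemma ite_sq_add_le (u v c : ℝ) :
    (if c < |u + v| then (u + v) ^ 2 else 0)
      ≤ 4 * (if c / 2 < |u| then u ^ 2 else 0) + 4 * v ^ 2 := by
  have hA : 0 ≤ (if c / 2 < |u| then u ^ 2 else 0) := by split_ifs <;> positivity
  split_ifs with h1 h2 h2
  · nlinarith [sq_nonneg (u - v), sq_nonneg u, sq_nonneg v]
  · have h3 := abs_add_le u v
    have h4 : |u| ≤ |v| := by linarith [not_lt.1 h2]
    have h5 : u ^ 2 ≤ v ^ 2 := sq_le_sq.2 h4
    nlinarith [sq_nonneg (u - v)]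
  · positivity
  · positivity

lemma lindTail_add_le {b : ℕ} (hb : 0 < b) (w r : Fin b → ℝ) (c : ℝ) :
    lindTail (fun a => w a + r a) c
      ≤ 16 * ((∑ a, if c / 4 < |w a| then w a ^ 2 else 0) / b) + 16 * empMean w ^ 2
        + 4 * ((∑ a, r a ^ 2) / b) := by
  have hb' : (0 : ℝ) < b := by positivity
  have hr : (∑ a, (r a - empMean r) ^ 2) / b ≤ (∑ a, r a ^ 2) / b := by
    have := empVar_eq hb r
    rw [empVar] at this
    nlinarith [sq_nonneg (empMean r)]
  have hw : 16 * empMean w ^ 2 = (∑ _a : Fin b, 16 * empMean w ^ 2) / b := by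
    simp; field_simp
  calc lindTail (fun a => w a + r a) c
      ≤ (∑ a, (16 * (if c / 4 < |w a| then w a ^ 2 else 0) + 16 * empMean w ^ 2
          + 4 * (r a - empMean r) ^ 2)) / b := by
        unfold lindTail
        refine div_le_div_of_nonneg_right (Finset.sum_le_sum fun a _ => ?_) hb'.le
        have h1 := ite_sq_add_le (w a + -empMean w) (r a - empMean r) c
        have h2 := ite_sq_add_le (w a) (-empMean w) (c / 2)
        rw [empMean_add]
        have e : w a + r a - (empMean w + empMean r) = w a + -empMean w + (r a - empMean r) := by
          ring
        rw [e]
        have e2 : c / 2 / 2 = c / 4 := by ring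
        rw [e2] at h2
        nlinarith
    _ = 16 * ((∑ a, if c / 4 < |w a| then w a ^ 2 else 0) / b) + 16 * empMean w ^ 2
        + 4 * ((∑ a, (r a - empMean r) ^ 2) / b) := by
        rw [Finset.sum_add_distrib, Finset.sum_add_distrib, add_div, add_div, ← hw,
          ← Finset.mul_sum, ← Finset.mul_sum]
        ring
    _ ≤ _ := by linarith

lemma measurable_empMean {b : ℕ} : Measurable (empMean (b := b)) := by
  unfold empMean; fun_prop

lemma measurable_empVar {b : ℕ} : Measurable (empVar (b := b)) := by
  have := measurable_empMean (b := b)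
  unfold empVar; fun_prop

lemma measurable_lindTail {b : ℕ} (c : ℝ) : Measurable fun x : Fin b → ℝ => lindTail x c := by
  have := measurable_empMean (b := b)
  unfold lindTail
  refine Measurable.div_const (Finset.measurable_sum _ fun a _ => Measurable.ite ?_ ?_ ?_) _
  · exact measurableSet_lt measurable_const (by fun_prop)
  · fun_prop
  · fun_prop

/-! ### The multinomial bootstrap law -/

/-- The multinomial law with equal cell probabilities. -/
noncomputable abbrev unifMultinomial (n b : ℕ) : Measure (Fin b → ℕ) :=
  multinomialLaw n fun _ : Fin b => (b : ℝ≥0∞)⁻¹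

/-- The centred and scaled bootstrap replicate of the list `x` with counts `m`. -/
noncomputable def bootRoot {b : ℕ} (n : ℕ) (x : Fin b → ℝ) (m : Fin b → ℕ) : ℝ :=
  √(n : ℝ) * (reweightedMean n m x - empMean x)

/-- The conditional law of the centred and scaled bootstrap replicate when the frozen
contributions are `x`. -/
noncomputable def bootLaw {b : ℕ} (n : ℕ) (x : Fin b → ℝ) : Measure ℝ :=
  (unifMultinomial n b).map (bootRoot n x)

/-- The empirical law of a finite list of reals. -/
noncomputable def empLaw {b : ℕ} (y : Fin b → ℝ) : Measure ℝ :=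
  ∑ a, (b : ℝ≥0∞)⁻¹ • Measure.dirac (y a)

lemma integral_empLaw {E : Type*} [NormedAddCommGroup E] [NormedSpace ℝ E] [CompleteSpace E]
    {b : ℕ} (hb : 0 < b) (y : Fin b → ℝ) (f : ℝ → E) :
    ∫ t, f t ∂(empLaw y) = ∑ a, (b : ℝ)⁻¹ • f (y a) := by
  have hb0 : (b : ℝ≥0∞) ≠ 0 := by exact_mod_cast hb.ne'
  rw [empLaw, integral_finsetSum_measure]
  · simp [integral_smul_measure]
  · intro a _
    exact (integrable_dirac (by simp)).smul_measure (ENNReal.inv_ne_top.2 hb0)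

lemma isProbabilityMeasure_empLaw {b : ℕ} (hb : 0 < b) (y : Fin b → ℝ) :
    IsProbabilityMeasure (empLaw y) := by
  have hb0 : (b : ℝ≥0∞) ≠ 0 := by exact_mod_cast hb.ne'
  constructor
  simp [empLaw, ENNReal.mul_inv_cancel hb0]

lemma memLp_empLaw {b : ℕ} (hb : 0 < b) (y : Fin b → ℝ) (p : ℝ≥0∞) :
    MemLp id p (empLaw y) := by
  have hb0 : (b : ℝ≥0∞) ≠ 0 := by exact_mod_cast hb.ne'
  have := isProbabilityMeasure_empLaw hb y
  refine MemLp.of_bound (by fun_prop) (∑ a, |y a|) ?_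
  simp only [empLaw]
  rw [ae_iff]
  simp only [Measure.coe_finsetSum, Finset.sum_apply, Measure.smul_apply, smul_eq_mul,
    Finset.sum_eq_zero_iff, Finset.mem_univ, true_implies, mul_eq_zero]
  intro a
  right
  rw [Measure.dirac_apply]
  simp only [id, Real.norm_eq_abs, not_le, Set.indicator_apply_eq_zero, Set.mem_ofPred_eq,
    Pi.one_apply, one_ne_zero, imp_false, not_lt]
  exact Finset.single_le_sum (f := fun a => |y a|) (fun _ _ => abs_nonneg _) (Finset.mem_univ a)

lemma integral_unifMultinomial {E : Type*} [NormedAddCommGroup E] [NormedSpace ℝ E]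
    [CompleteSpace E] {b : ℕ} (hb : 0 < b) (n : ℕ) (f : (Fin b → ℕ) → E) :
    ∫ m, f m ∂(unifMultinomial n b) = ∑ m ∈ Finset.piAntidiag (Finset.univ : Finset (Fin b)) n,
      ((Nat.multinomial Finset.univ m : ℝ) * ∏ a, (b : ℝ)⁻¹ ^ m a) • f m := by
  have hb0 : (b : ℝ≥0∞) ≠ 0 := by exact_mod_cast hb.ne'
  have htop (m : Fin b → ℕ) :
      (Nat.multinomial Finset.univ m : ℝ≥0∞) * ∏ a, (b : ℝ≥0∞)⁻¹ ^ m a ≠ ∞ :=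
    ENNReal.mul_ne_top (by simp) (ENNReal.prod_ne_top fun a _ =>
      ENNReal.pow_ne_top (ENNReal.inv_ne_top.2 hb0))
  rw [unifMultinomial, multinomialLaw, integral_finsetSum_measure]
  · refine Finset.sum_congr rfl fun m _ => ?_
    rw [integral_smul_measure, integral_dirac]
    congr 1
    simp [ENNReal.toReal_mul, ENNReal.toReal_prod]
  · intro m _
    exact (integrable_dirac (by simp)).smul_measure (htop m)

lemma isProbabilityMeasure_unifMultinomial {b : ℕ} (hb : 0 < b) (n : ℕ) :
    IsProbabilityMeasure (unifMultinomial n b) := by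
  have hb0 : (b : ℝ≥0∞) ≠ 0 := by exact_mod_cast hb.ne'
  constructor
  have := Finset.sum_pow_eq_sum_piAntidiag (Finset.univ : Finset (Fin b))
    (fun _ => (b : ℝ≥0∞)⁻¹) n
  simp only [Finset.sum_const, Finset.card_univ, Fintype.card_fin, nsmul_eq_mul,
    ENNReal.mul_inv_cancel hb0 (by simp), one_pow] at this
  simp [multinomialLaw, ← this]

lemma measurable_bootRoot {b : ℕ} (n : ℕ) :
    Measurable fun p : (Fin b → ℝ) × (Fin b → ℕ) => bootRoot n p.1 p.2 := by
  have := measurable_empMean (b := b)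
  unfold bootRoot reweightedMean
  fun_prop

lemma isProbabilityMeasure_bootLaw {b : ℕ} (hb : 0 < b) (n : ℕ) (x : Fin b → ℝ) :
    IsProbabilityMeasure (bootLaw n x) := by
  have := isProbabilityMeasure_unifMultinomial hb n
  exact Measure.isProbabilityMeasure_map (Measurable.of_discrete).aemeasurable

/-- The list of centred contributions, divided by the square root of the number of trials. -/
noncomputable def scaledDev {b : ℕ} (n : ℕ) (x : Fin b → ℝ) (a : Fin b) : ℝ :=
  (x a - empMean x) / √(n : ℝ)

lemma bootRoot_eq {b : ℕ} {n : ℕ} (hn : 0 < n) (x : Fin b → ℝ) {m : Fin b → ℕ}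
    (hm : m ∈ Finset.piAntidiag (Finset.univ : Finset (Fin b)) n) :
    bootRoot n x m = ∑ a, (m a : ℝ) * scaledDev n x a := by
  have hn' : (0 : ℝ) < n := by exact_mod_cast hn
  have hs : √(n : ℝ) ≠ 0 := (Real.sqrt_pos.2 hn').ne'
  have hm' : (∑ a, (m a : ℝ)) = n := by exact_mod_cast (Finset.mem_piAntidiag.1 hm).1
  have h1 : ∑ a, (m a : ℝ) * scaledDev n x a
      = (∑ a, (m a : ℝ) * x a - n * empMean x) / √(n : ℝ) := by
    rw [← hm', Finset.sum_mul, ← Finset.sum_sub_distrib, Finset.sum_div]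
    rw [hm']
    exact Finset.sum_congr rfl fun a _ => by rw [scaledDev]; ring
  rw [h1, bootRoot, reweightedMean]
  have h2 : √(n : ℝ) * √(n : ℝ) = n := Real.mul_self_sqrt hn'.le
  rw [eq_div_iff hs]
  have : √(n : ℝ) * ((∑ a, (m a : ℝ) * x a) / n - empMean x) * √(n : ℝ)
    = (√(n : ℝ) * √(n : ℝ)) * ((∑ a, (m a : ℝ) * x a) / n - empMean x) := by ring
  rw [this, h2]
  field_simp

/-- By the multinomial theorem, the characteristic function of the bootstrap law is that of a sum
of `n` independent draws from the list of scaled deviations. -/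
lemma charFun_bootLaw {b : ℕ} (hb : 0 < b) {n : ℕ} (hn : 0 < n) (x : Fin b → ℝ) (t : ℝ) :
    charFun (bootLaw n x) t
      = (∑ a, ((b : ℝ)⁻¹ : ℂ) * Complex.exp (t * scaledDev n x a * Complex.I)) ^ n := by
  rw [charFun_apply_real, bootLaw, integral_map (Measurable.of_discrete).aemeasurable (by fun_prop),
    integral_unifMultinomial hb, Finset.sum_pow_eq_sum_piAntidiag]
  refine Finset.sum_congr rfl fun m hm => ?_
  rw [bootRoot_eq hn x hm]
  simp only [mul_pow, Finset.prod_mul_distrib, ← Complex.exp_nat_mul, ← Complex.exp_sum]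
  rw [Complex.real_smul]
  push_cast
  rw [mul_assoc]
  congr 3
  rw [Finset.mul_sum, Finset.sum_mul]
  exact Finset.sum_congr rfl fun a _ => by ring

lemma charFun_empLaw {b : ℕ} (hb : 0 < b) (y : Fin b → ℝ) (t : ℝ) :
    charFun (empLaw y) t = ∑ a, ((b : ℝ)⁻¹ : ℂ) * Complex.exp (t * y a * Complex.I) := by
  rw [charFun_apply_real, integral_empLaw hb]
  simp

lemma bootLaw_eq_map_pi {b : ℕ} (hb : 0 < b) {n : ℕ} (hn : 0 < n) (x : Fin b → ℝ) :
    bootLaw n x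
      = (Measure.pi fun _ : Fin n => empLaw (scaledDev n x)).map fun p => ∑ i, p i := by
  have := isProbabilityMeasure_empLaw hb (scaledDev n x)
  have := isProbabilityMeasure_bootLaw hb n x
  have : IsProbabilityMeasure
      ((Measure.pi fun _ : Fin n => empLaw (scaledDev n x)).map fun p => ∑ i, p i) :=
    Measure.isProbabilityMeasure_map (by fun_prop)
  refine Measure.ext_of_charFun ?_
  rw [charFun_map_sum_pi_eq_prod]
  ext t
  simp [charFun_bootLaw hb hn, charFun_empLaw hb]

lemma sum_scaledDev {b : ℕ} (hb : 0 < b) (n : ℕ) (x : Fin b → ℝ) :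
    ∑ a, scaledDev n x a = 0 := by
  simp only [scaledDev, ← Finset.sum_div, sum_sub_empMean hb, zero_div]

lemma sum_scaledDev_sq {b : ℕ} (n : ℕ) (x : Fin b → ℝ) :
    ∑ a, (b : ℝ)⁻¹ * scaledDev n x a ^ 2 = empVar x / n := by
  simp only [scaledDev, div_pow, Real.sq_sqrt (Nat.cast_nonneg n), empVar, Finset.sum_div]
  exact Finset.sum_congr rfl fun a _ => by ring

/-- The bootstrap law is centred with variance `empVar x`. -/
lemma lintegral_sq_bootLaw {b : ℕ} (hb : 0 < b) {n : ℕ} (hn : 0 < n) (x : Fin b → ℝ) :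
    ∫⁻ t, ENNReal.ofReal (t ^ 2) ∂(bootLaw n x) = ENNReal.ofReal (empVar x) := by
  have := isProbabilityMeasure_empLaw hb (scaledDev n x)
  have hL := memLp_empLaw hb (scaledDev n x) 2
  have hmean : ∫ t, t ∂(empLaw (scaledDev n x)) = 0 := by
    rw [integral_empLaw hb]
    simp only [smul_eq_mul, ← Finset.mul_sum, sum_scaledDev hb, mul_zero]
  have hvar1 : Var[id; empLaw (scaledDev n x)] = empVar x / n := by
    rw [variance_eq_integral (by fun_prop)]
    simp only [id, hmean, sub_zero]
    rw [integral_empLaw hb]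
    simpa using sum_scaledDev_sq n x
  have hvar := variance_sum_pi (ι := Fin n) (μ := fun _ => empLaw (scaledDev n x))
    (X := fun _ => id) (fun _ => hL)
  have hmem : MemLp (fun p : Fin n → ℝ => ∑ i, p i) 2
      (Measure.pi fun _ : Fin n => empLaw (scaledDev n x)) :=
    memLp_finsetSum _ fun i _ => hL.comp_measurePreserving (measurePreserving_eval _ i)
  have hmean2 : ∫ p, (∑ i, p i) ∂(Measure.pi fun _ : Fin n => empLaw (scaledDev n x)) = 0 := by
    rw [integral_finsetSum]
    · refine Finset.sum_eq_zero fun i _ => ?_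
      rw [← hmean]
      exact integral_comp_eval (μ := fun _ : Fin n => empLaw (scaledDev n x)) (i := i) (f := id)
        (by fun_prop)
    · intro i _
      exact (hL.comp_measurePreserving (measurePreserving_eval _ i)).integrable one_le_two
  have hn' : (n : ℝ) ≠ 0 := by exact_mod_cast hn.ne'
  rw [bootLaw_eq_map_pi hb hn, lintegral_map (by fun_prop) (by fun_prop),
    ← ofReal_integral_eq_lintegral_ofReal hmem.integrable_sq (ae_of_all _ fun _ => sq_nonneg _)]
  congr 1
  have e : (∑ i : Fin n, fun ω : Fin n → ℝ => id (ω i)) = fun p : Fin n → ℝ => ∑ i, p i := by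
    ext p; simp
  rw [e, variance_eq_integral (by fun_prop), hmean2] at hvar
  simp only [sub_zero] at hvar
  rw [hvar]
  simp only [hvar1, Finset.sum_const, Finset.card_univ, Fintype.card_fin, nsmul_eq_mul]
  field_simp

/-! ### Lindeberg's central limit theorem for the bootstrap law -/

/-- Second-order Taylor expansion of `u ↦ exp (i u)` with a remainder that is both of second and
of third order. -/
lemma norm_exp_taylor_le (u : ℝ) :
    ‖Complex.exp (u * Complex.I) - (1 + u * Complex.I - (u : ℂ) ^ 2 / 2)‖
      ≤ 4 * u ^ 2 * min 1 |u| := by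
  rcases le_or_gt |u| 1 with hu | hu
  · have h := Complex.norm_exp_sub_sum_le_norm_mul_exp (u * Complex.I) 3
    have e : ∑ m ∈ Finset.range 3, ((u : ℂ) * Complex.I) ^ m / (m.factorial : ℂ)
        = 1 + u * Complex.I - (u : ℂ) ^ 2 / 2 := by
      simp [Finset.sum_range_succ, mul_pow]
      ring
    have hn : ‖(u : ℂ) * Complex.I‖ = |u| := by simp
    rw [e, hn] at h
    refine h.trans ?_
    have h1 : Real.exp |u| ≤ 4 := by
      have := Real.exp_le_exp.2 hu
      linarith [Real.exp_one_lt_d9]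
    rw [min_eq_right hu, ← sq_abs u]
    have h3 : 0 ≤ |u| ^ 3 := by positivity
    nlinarith
  · rw [min_eq_left hu.le]
    have h1 : ‖Complex.exp (u * Complex.I)‖ = 1 := Complex.norm_exp_ofReal_mul_I u
    have h2 : ‖(1 : ℂ) + u * Complex.I - (u : ℂ) ^ 2 / 2‖ ≤ 1 + |u| + u ^ 2 / 2 := by
      refine (norm_sub_le _ _).trans (add_le_add ((norm_add_le _ _).trans ?_) ?_)
      · simp
      · simp
    refine (norm_sub_le _ _).trans ?_
    rw [h1]
    nlinarith [sq_abs u]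

/-- Lindeberg's estimate of the characteristic function of a single draw from the list of scaled
deviations. -/
lemma norm_sum_exp_scaledDev_sub_le {b : ℕ} (hb : 0 < b) {n : ℕ} (hn : 0 < n) (x : Fin b → ℝ)
    (t : ℝ) {δ : ℝ} (hδ : 0 ≤ δ) :
    ‖(∑ a, ((b : ℝ)⁻¹ : ℂ) * Complex.exp (t * scaledDev n x a * Complex.I))
        - ((1 - t ^ 2 * empVar x / (2 * n) : ℝ) : ℂ)‖
      ≤ 4 * t ^ 2 * (|t| * δ * empVar x + lindTail x (δ * √(n : ℝ))) / n := by
  have hn' : (0 : ℝ) < n := by exact_mod_cast hn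
  have hb' : (0 : ℝ) < b := by exact_mod_cast hb
  have hbC : ((b : ℝ) : ℂ) ≠ 0 := by exact_mod_cast hb.ne'
  have hs : 0 < √(n : ℝ) := Real.sqrt_pos.2 hn'
  have e0 : ((1 - t ^ 2 * empVar x / (2 * n) : ℝ) : ℂ)
      = ∑ a, ((b : ℝ)⁻¹ : ℂ) * (1 + ((t * scaledDev n x a : ℝ) : ℂ) * Complex.I
          - ((t * scaledDev n x a : ℝ) : ℂ) ^ 2 / 2) := by
    have s1 : ∑ _a : Fin b, ((b : ℝ)⁻¹ : ℂ) = 1 := by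
      simp only [Finset.sum_const, Finset.card_univ, Fintype.card_fin, nsmul_eq_mul]
      exact mul_inv_cancel₀ hbC
    have s2 : ∑ a, ((scaledDev n x a : ℝ) : ℂ) = 0 := by
      exact_mod_cast sum_scaledDev hb n x
    have s3 : ∑ a, ((b : ℝ)⁻¹ : ℂ) * ((scaledDev n x a : ℝ) : ℂ) ^ 2
        = ((empVar x / n : ℝ) : ℂ) := by
      rw [← sum_scaledDev_sq n x]; push_cast; rfl
    have : ∀ a, ((b : ℝ)⁻¹ : ℂ) * (1 + ((t * scaledDev n x a : ℝ) : ℂ) * Complex.I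
          - ((t * scaledDev n x a : ℝ) : ℂ) ^ 2 / 2)
        = ((b : ℝ)⁻¹ : ℂ) + (((b : ℝ)⁻¹ : ℂ) * t * Complex.I) * ((scaledDev n x a : ℝ) : ℂ)
          - ((t : ℂ) ^ 2 / 2) * (((b : ℝ)⁻¹ : ℂ) * ((scaledDev n x a : ℝ) : ℂ) ^ 2) := by
      intro a; push_cast; ring
    simp only [this, Finset.sum_sub_distrib, Finset.sum_add_distrib, ← Finset.mul_sum, s1, s2, s3]
    push_cast
    ring
  rw [e0, ← Finset.sum_sub_distrib]
  have key : ∀ a, ‖((b : ℝ)⁻¹ : ℂ) * Complex.exp (t * scaledDev n x a * Complex.I)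
      - ((b : ℝ)⁻¹ : ℂ) * (1 + ((t * scaledDev n x a : ℝ) : ℂ) * Complex.I
          - ((t * scaledDev n x a : ℝ) : ℂ) ^ 2 / 2)‖
      ≤ 4 * t ^ 2 / n / b * (|t| * δ * (x a - empMean x) ^ 2
        + (if δ * √(n : ℝ) < |x a - empMean x| then (x a - empMean x) ^ 2 else 0)) := by
    intro a
    have h := norm_exp_taylor_le (t * scaledDev n x a)
    have hsq : scaledDev n x a ^ 2 = (x a - empMean x) ^ 2 / n := by
      rw [scaledDev, div_pow, Real.sq_sqrt hn'.le]
    rw [← mul_sub, norm_mul]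
    have hbn : ‖((b : ℝ)⁻¹ : ℂ)‖ = (b : ℝ)⁻¹ := by simp
    rw [hbn]
    have h2 : (x a - empMean x) ^ 2 * min 1 |t * scaledDev n x a|
        ≤ |t| * δ * (x a - empMean x) ^ 2
        + (if δ * √(n : ℝ) < |x a - empMean x| then (x a - empMean x) ^ 2 else 0) := by
      split_ifs with hc
      · have : 0 ≤ |t| * δ * (x a - empMean x) ^ 2 := by positivity
        have h3 : min 1 |t * scaledDev n x a| ≤ 1 := min_le_left _ _
        nlinarith [sq_nonneg (x a - empMean x)]
      · have h3 : min 1 |t * scaledDev n x a| ≤ |t| * δ := by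
          refine (min_le_right _ _).trans ?_
          rw [abs_mul]
          refine mul_le_mul_of_nonneg_left ?_ (abs_nonneg t)
          rw [scaledDev, abs_div, abs_of_pos hs, div_le_iff₀ hs]
          exact not_lt.1 hc
        nlinarith [sq_nonneg (x a - empMean x)]
    have e1 : Complex.exp (t * scaledDev n x a * Complex.I)
        = Complex.exp (((t * scaledDev n x a : ℝ) : ℂ) * Complex.I) := by push_cast; rfl
    rw [e1]
    calc _ ≤ (b : ℝ)⁻¹ * (4 * (t * scaledDev n x a) ^ 2 * min 1 |t * scaledDev n x a|) :=
          mul_le_mul_of_nonneg_left h (by positivity)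
      _ = 4 * t ^ 2 / n / b * ((x a - empMean x) ^ 2 * min 1 |t * scaledDev n x a|) := by
          rw [mul_pow, hsq]; ring
      _ ≤ _ := mul_le_mul_of_nonneg_left h2 (by positivity)
  refine (norm_sum_le _ _).trans ((Finset.sum_le_sum fun a _ => key a).trans (le_of_eq ?_))
  rw [← Finset.mul_sum, Finset.sum_add_distrib, ← Finset.mul_sum, empVar, lindTail]
  field_simp

lemma norm_pow_sub_pow_le {z w : ℂ} (hz : ‖z‖ ≤ 1) (hw : ‖w‖ ≤ 1) (n : ℕ) :
    ‖z ^ n - w ^ n‖ ≤ n * ‖z - w‖ := by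
  induction n with
  | zero => simp
  | succ n ih =>
    have e : z ^ (n + 1) - w ^ (n + 1) = z ^ n * (z - w) + (z ^ n - w ^ n) * w := by ring
    rw [e]
    refine (norm_add_le _ _).trans ?_
    rw [norm_mul, norm_mul, norm_pow]
    have h1 : ‖z‖ ^ n ≤ 1 := pow_le_one₀ (norm_nonneg _) hz
    have h2 : ‖z ^ n - w ^ n‖ * ‖w‖ ≤ ‖z ^ n - w ^ n‖ :=
      mul_le_of_le_one_right (norm_nonneg _) hw
    have h3 : ‖z‖ ^ n * ‖z - w‖ ≤ ‖z - w‖ := mul_le_of_le_one_left (norm_nonneg _) h1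
    push_cast
    linarith

/-- Quantitative comparison of the characteristic function of the bootstrap law with that of
`N(0, V)`. -/
lemma norm_charFun_bootLaw_sub_le {b : ℕ} (hb : 0 < b) {n : ℕ} (hn : 0 < n) (x : Fin b → ℝ)
    {V : ℝ} (hV : 0 ≤ V) (t : ℝ) (hnt : t ^ 2 * V / 2 ≤ n) {δ : ℝ} (hδ : 0 ≤ δ) :
    ‖charFun (bootLaw n x) t - charFun (gaussianReal 0 V.toNNReal) t‖
      ≤ 4 * t ^ 2 * (|t| * δ * empVar x + lindTail x (δ * √(n : ℝ)))
        + t ^ 2 / 2 * |empVar x - V| + (t ^ 2 * V / 2) ^ 2 / n := by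
  have hn' : (0 : ℝ) < n := by exact_mod_cast hn
  have hb' : (0 : ℝ) < b := by exact_mod_cast hb
  set c := t ^ 2 * V / 2 with hc
  have hc0 : 0 ≤ c := by positivity
  set z := ∑ a, ((b : ℝ)⁻¹ : ℂ) * Complex.exp (t * scaledDev n x a * Complex.I) with hz
  set w : ℂ := ((Real.exp (-(c / n)) : ℝ) : ℂ) with hw
  have hg : charFun (gaussianReal 0 V.toNNReal) t = w ^ n := by
    rw [charFun_gaussianReal, hw, Complex.ofReal_exp, ← Complex.exp_nat_mul,
      Real.coe_toNNReal _ hV, hc]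
    congr 1
    push_cast
    have : (n : ℂ) ≠ 0 := by exact_mod_cast hn.ne'
    field_simp
    ring
  have hz1 : ‖z‖ ≤ 1 := by
    refine (norm_sum_le _ _).trans (le_of_eq ?_)
    have : ∀ a : Fin b, ‖((b : ℝ)⁻¹ : ℂ) * Complex.exp (t * scaledDev n x a * Complex.I)‖
        = (b : ℝ)⁻¹ := by
      intro a
      rw [norm_mul, ← Complex.ofReal_mul, Complex.norm_exp_ofReal_mul_I]
      simp
    simp only [this, Finset.sum_const, Finset.card_univ, Fintype.card_fin, nsmul_eq_mul]
    exact mul_inv_cancel₀ hb'.ne'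
  have hw1 : ‖w‖ ≤ 1 := by
    rw [hw, Complex.norm_real, Real.norm_eq_abs, Real.abs_exp, Real.exp_le_one_iff]
    have : 0 ≤ c / n := by positivity
    linarith
  rw [charFun_bootLaw hb hn, hg]
  refine (norm_pow_sub_pow_le hz1 hw1 n).trans ?_
  have h1 := norm_sum_exp_scaledDev_sub_le hb hn x t hδ
  rw [← hz] at h1
  have h2 : ‖((1 - t ^ 2 * empVar x / (2 * n) : ℝ) : ℂ) - w‖
      ≤ (t ^ 2 / 2 * |empVar x - V| + c ^ 2 / n) / n := by
    rw [hw, ← Complex.ofReal_sub, Complex.norm_real, Real.norm_eq_abs]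
    have hcn : |-(c / n)| ≤ 1 := by
      rw [abs_neg, abs_of_nonneg (by positivity)]
      exact (div_le_one hn').2 hnt
    have h3 := Real.abs_exp_sub_one_sub_id_le hcn
    have e : 1 - t ^ 2 * empVar x / (2 * n) - Real.exp (-(c / n))
        = -(t ^ 2 / 2 * (empVar x - V) / n) - (Real.exp (-(c / n)) - 1 - -(c / n)) := by
      rw [hc]; field_simp; ring
    rw [e]
    refine (abs_sub _ _).trans ((add_le_add le_rfl h3).trans (le_of_eq ?_))
    rw [abs_neg, abs_div, abs_mul, abs_of_pos hn', abs_of_nonneg (by positivity : 0 ≤ t ^ 2 / 2)]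
    field_simp
  have h4 : ‖z - w‖ ≤ 4 * t ^ 2 * (|t| * δ * empVar x + lindTail x (δ * √(n : ℝ))) / n
      + (t ^ 2 / 2 * |empVar x - V| + c ^ 2 / n) / n := by
    have : z - w = (z - ((1 - t ^ 2 * empVar x / (2 * n) : ℝ) : ℂ))
      + (((1 - t ^ 2 * empVar x / (2 * n) : ℝ) : ℂ) - w) := by ring
    rw [this]
    exact (norm_add_le _ _).trans (add_le_add h1 h2)
  refine (mul_le_mul_of_nonneg_left h4 hn'.le).trans (le_of_eq ?_)
  field_simp
  ring

/-- Pointwise convergence of characteristic functions implies convergence in the Lévy–Prokhorov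
distance. -/
lemma tendsto_levyProkhorovDist_of_charFun {P : ℕ → Measure ℝ} [∀ j, IsProbabilityMeasure (P j)]
    {Q : Measure ℝ} [IsProbabilityMeasure Q]
    (h : ∀ t, Tendsto (fun j => charFun (P j) t) atTop (𝓝 (charFun Q t))) :
    Tendsto (fun j => levyProkhorovDist (P j) Q) atTop (𝓝 0) := by
  have h1 := ProbabilityMeasure.tendsto_of_tendsto_charFun
    (μ := fun j => (⟨P j, inferInstance⟩ : ProbabilityMeasure ℝ)) (μ₀ := ⟨Q, inferInstance⟩) h
  have h2 := ((LevyProkhorov.continuous_ofMeasure_probabilityMeasure (Ω := ℝ)).tendsto _).comp h1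
  exact tendsto_iff_dist_tendsto_zero.1 h2

/-- The set of lists of contributions for which the bootstrap law with `n` trials is close to
`N(0, V)`: empirical variance close to `V`, and a small Lindeberg tail. -/
def cltSet (b : ℕ) (V δ : ℝ) (n : ℕ) : Set (Fin b → ℝ) :=
  {x | |empVar x - V| ≤ δ ∧ lindTail x (δ * √(n : ℝ)) ≤ δ}

lemma measurableSet_cltSet {b : ℕ} (V δ : ℝ) (n : ℕ) : MeasurableSet (cltSet b V δ n) := by
  have h1 := measurable_empVar (b := b)
  have h2 := measurable_lindTail (b := b) (δ * √(n : ℝ))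
  exact (measurableSet_le (h1.sub_const V).abs measurable_const).inter
    (measurableSet_le h2 measurable_const)

lemma lindTail_anti {b : ℕ} (x : Fin b → ℝ) {c d : ℝ} (h : c ≤ d) :
    lindTail x d ≤ lindTail x c := by
  unfold lindTail
  refine div_le_div_of_nonneg_right (Finset.sum_le_sum fun a _ => ?_) (Nat.cast_nonneg b)
  split_ifs with h1 h2 h2
  · exact le_rfl
  · exact absurd (h.trans_lt h1) h2
  · positivity
  · exact le_rfl

lemma cltSet_mono {b : ℕ} (V : ℝ) (n : ℕ) {δ δ' : ℝ} (h : δ ≤ δ') :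
    cltSet b V δ n ⊆ cltSet b V δ' n := fun x hx =>
  ⟨hx.1.trans h, (lindTail_anti x (by gcongr)).trans (hx.2.trans h)⟩

/-- The Lindeberg central limit theorem in a form uniform over the lists of contributions. -/
lemma exists_forall_levyProkhorovDist_bootLaw_lt {V : ℝ} (hV : 0 ≤ V) {ε : ℝ} (hε : 0 < ε) :
    ∃ δ > 0, ∀ᶠ n in atTop, ∀ b, 0 < b → ∀ x ∈ cltSet b V δ n,
      levyProkhorovDist (bootLaw n x) (gaussianReal 0 V.toNNReal) < ε := by
  by_contra! hcon
  have hfreq : ∀ j : ℕ, ∃ n, j + 1 ≤ n ∧ ∃ b, 0 < b ∧ ∃ x ∈ cltSet b V (1 / (j + 1 : ℝ)) n,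
      ε ≤ levyProkhorovDist (bootLaw n x) (gaussianReal 0 V.toNNReal) := by
    intro j
    have h := hcon (1 / (j + 1 : ℝ)) (by positivity)
    obtain ⟨n, hn, h⟩ := (frequently_atTop.1 h) (j + 1)
    exact ⟨n, hn, h⟩
  choose n hn b hb x hx hfar using hfreq
  have hn0 (j) : 0 < n j := by have := hn j; omega
  have hprob (j) := isProbabilityMeasure_bootLaw (hb j) (n j) (x j)
  have hlim : Tendsto (fun j => levyProkhorovDist (bootLaw (n j) (x j))
      (gaussianReal 0 V.toNNReal)) atTop (𝓝 0) := by
    refine tendsto_levyProkhorovDist_of_charFun fun t => ?_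
    rw [tendsto_iff_norm_sub_tendsto_zero]
    have hδ0 : Tendsto (fun j : ℕ => 1 / ((j : ℝ) + 1)) atTop (𝓝 0) :=
      tendsto_one_div_add_atTop_nhds_zero_nat
    have hbound : Tendsto (fun j : ℕ => 4 * t ^ 2 * (|t| * (1 / ((j : ℝ) + 1)) * (V + 1)
        + 1 / ((j : ℝ) + 1)) + t ^ 2 / 2 * (1 / ((j : ℝ) + 1))
        + (t ^ 2 * V / 2) ^ 2 * (1 / ((j : ℝ) + 1))) atTop (𝓝 0) := by
      have := ((((hδ0.const_mul |t|).mul_const (V + 1)).add hδ0).const_mul (4 * t ^ 2)).add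
        (hδ0.const_mul (t ^ 2 / 2)) |>.add (hδ0.const_mul ((t ^ 2 * V / 2) ^ 2))
      simpa using this
    refine squeeze_zero' (Eventually.of_forall fun _ => norm_nonneg _) ?_ hbound
    obtain ⟨N, hN⟩ := exists_nat_ge (t ^ 2 * V / 2)
    filter_upwards [eventually_ge_atTop N] with j hj
    have hjn : (j : ℝ) + 1 ≤ n j := by exact_mod_cast hn j
    have hNj : (N : ℝ) ≤ j := by exact_mod_cast hj
    have hpos : (0 : ℝ) < (j : ℝ) + 1 := by positivity
    have hδ1 : 1 / ((j : ℝ) + 1) ≤ 1 := by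
      rw [div_le_one hpos]; linarith [(Nat.cast_nonneg j : (0 : ℝ) ≤ j)]
    refine (norm_charFun_bootLaw_sub_le (hb j) (hn0 j) (x j) hV t (by linarith)
      (by positivity : 0 ≤ 1 / ((j : ℝ) + 1))).trans ?_
    obtain ⟨hx1, hx2⟩ := hx j
    have hx3 : empVar (x j) ≤ V + 1 := by linarith [(abs_le.1 hx1).2]
    have : (1 : ℝ) / n j ≤ 1 / ((j : ℝ) + 1) := one_div_le_one_div_of_le hpos hjn
    rw [div_eq_mul_one_div ((t ^ 2 * V / 2) ^ 2)]
    gcongr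
  exact (hlim.eventually_lt_const hε).exists.elim fun j hj => (hfar j).not_gt hj

lemma exists_forall_levyProkhorovDist_gaussianReal_lt {V : ℝ} (hV : 0 ≤ V) {ε : ℝ} (hε : 0 < ε) :
    ∃ δ > 0, ∀ v, 0 ≤ v → |v - V| ≤ δ →
      levyProkhorovDist (gaussianReal 0 v.toNNReal) (gaussianReal 0 V.toNNReal) < ε := by
  by_contra! hcon
  have (j : ℕ) := hcon (1 / (j + 1 : ℝ)) (by positivity)
  choose v hv0 hv hfar using this
  have hvV : Tendsto v atTop (𝓝 V) := by
    rw [tendsto_iff_norm_sub_tendsto_zero]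
    exact squeeze_zero (fun _ => norm_nonneg _) hv tendsto_one_div_add_atTop_nhds_zero_nat
  have hlim : Tendsto (fun j => levyProkhorovDist (gaussianReal 0 (v j).toNNReal)
      (gaussianReal 0 V.toNNReal)) atTop (𝓝 0) := by
    refine tendsto_levyProkhorovDist_of_charFun fun t => ?_
    simp only [charFun_gaussianReal, Real.coe_toNNReal _ hV, Real.coe_toNNReal _ (hv0 _)]
    have hc : Continuous fun u : ℝ => Complex.exp (t * ((0 : ℝ) : ℂ) * Complex.I
        - (u : ℂ) * (t : ℂ) ^ 2 / 2) := by fun_prop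
    exact (hc.tendsto V).comp hvV
  exact (hlim.eventually_lt_const hε).exists.elim fun j hj => (hfar j).not_gt hj

/-- Uniform central limit theorem with the Gaussian law of the variance of the list itself. -/
lemma exists_forall_levyProkhorovDist_bootLaw_empVar_lt {V : ℝ} (hV : 0 ≤ V) {ε : ℝ}
    (hε : 0 < ε) :
    ∃ δ > 0, ∀ᶠ n in atTop, ∀ b, 0 < b → ∀ x ∈ cltSet b V δ n,
      levyProkhorovDist (bootLaw n x) (gaussianReal 0 (empVar x).toNNReal) < ε := by
  obtain ⟨δ₁, hδ₁, h1⟩ := exists_forall_levyProkhorovDist_bootLaw_lt hV (half_pos hε)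
  obtain ⟨δ₂, hδ₂, h2⟩ := exists_forall_levyProkhorovDist_gaussianReal_lt hV (half_pos hε)
  refine ⟨min δ₁ δ₂, lt_min hδ₁ hδ₂, ?_⟩
  filter_upwards [h1] with n hn b hb x hx
  have := isProbabilityMeasure_bootLaw hb n x
  have e1 := hn b hb x (cltSet_mono V n (min_le_left _ _) hx)
  have e2 := h2 (empVar x) (empVar_nonneg x) (hx.1.trans (min_le_right _ _))
  rw [levyProkhorovDist_comm] at e2
  have := levyProkhorovDist_triangle (bootLaw n x) (gaussianReal 0 V.toNNReal)
    (gaussianReal 0 (empVar x).toNNReal)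
  linarith

/-! ### Empirical quantiles -/

/-- The empirical quantile is a generalised inverse of the empirical distribution function. -/
lemma empQuantile_le_iff {p : ℝ} (hp : p ∈ Set.Ioo (0 : ℝ) 1) {r : ℕ} (hr : 0 < r)
    (y : Fin r → ℝ) (t : ℝ) :
    empQuantile p y ≤ t ↔ p * r ≤ (Finset.univ.filter fun l => y l ≤ t).card := by
  have hr' : (0 : ℝ) < r := by exact_mod_cast hr
  set S : Set ℝ := {t : ℝ | p * r ≤ (Finset.univ.filter fun l => y l ≤ t).card} with hS
  have hmono : ∀ t ∈ S, ∀ t', t ≤ t' → t' ∈ S := by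
    intro t ht t' htt'
    refine le_trans (show p * r ≤ (Finset.univ.filter fun l => y l ≤ t).card from ht) ?_
    exact_mod_cast Finset.card_le_card fun l hl => by
      simp only [Finset.mem_filter, Finset.mem_univ, true_and] at hl ⊢
      exact hl.trans htt'
  have hne : S.Nonempty := by
    refine ⟨∑ l, |y l|, ?_⟩
    have : (Finset.univ.filter fun l => y l ≤ ∑ l, |y l|) = Finset.univ := by
      refine Finset.filter_true_of_mem fun l _ => (le_abs_self _).trans ?_
      exact Finset.single_le_sum (f := fun l => |y l|) (fun _ _ => abs_nonneg _)
        (Finset.mem_univ l)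
    simp only [hS, Set.mem_ofPred_eq, this, Finset.card_univ, Fintype.card_fin]
    nlinarith [hp.2]
  have hbdd : BddBelow S := by
    refine ⟨-∑ l, |y l|, fun t ht => ?_⟩
    have hpos : (0 : ℝ) < (Finset.univ.filter fun l => y l ≤ t).card :=
      (mul_pos hp.1 hr').trans_le ht
    obtain ⟨l, hl⟩ := Finset.card_pos.1 (by exact_mod_cast hpos)
    have h1 := Finset.single_le_sum (f := fun l => |y l|) (fun _ _ => abs_nonneg _)
        (Finset.mem_univ l)
    have h2 := (Finset.mem_filter.1 hl).2
    have h3 := neg_abs_le (y l)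
    linarith
  have hclosed : IsClosed S := by
    have : S = ⋃ A ∈ (Finset.univ.filter fun A : Finset (Fin r) => p * r ≤ A.card),
        ⋂ l ∈ A, Set.Ici (y l) := by
      ext t
      simp only [hS, Set.mem_ofPred_eq, Finset.mem_filter, Finset.mem_univ, true_and,
        Set.mem_iUnion, Set.mem_iInter, Set.mem_Ici, exists_prop]
      constructor
      · intro h
        exact ⟨_, h, fun l hl => (Finset.mem_filter.1 hl).2⟩
      · rintro ⟨A, hA, h⟩
        refine hA.trans ?_
        exact_mod_cast Finset.card_le_card fun l hl => by simpa using h l hl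
    rw [this]
    exact isClosed_biUnion_finset fun A _ => isClosed_biInter fun l _ => isClosed_Ici
  constructor
  · intro h
    exact hmono _ (hclosed.csInf_mem hne hbdd) t h
  · intro h
    exact csInf_le hbdd h

lemma empQuantile_affine {p : ℝ} (hp : p ∈ Set.Ioo (0 : ℝ) 1) {r : ℕ} (hr : 0 < r)
    (y : Fin r → ℝ) {c : ℝ} (hc : 0 < c) (d : ℝ) :
    empQuantile p (fun l => c * (y l - d)) = c * (empQuantile p y - d) := by
  refine eq_of_forall_ge_iff fun t => ?_
  have h (u : ℝ) : c * (u - d) ≤ t ↔ u ≤ t / c + d := by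
    rw [← sub_le_iff_le_add, le_div_iff₀ hc, mul_comm]
  rw [h, empQuantile_le_iff hp hr, empQuantile_le_iff hp hr]
  simp only [h]

/-- Chebyshev's inequality for empirical quantiles. -/
lemma empQuantile_sq_le {p : ℝ} (hp : p ∈ Set.Ioo (0 : ℝ) 1) {r : ℕ} (hr : 0 < r)
    (y : Fin r → ℝ) :
    min p (1 - p) * empQuantile p y ^ 2 ≤ (∑ l, y l ^ 2) / r := by
  have hr' : (0 : ℝ) < r := by exact_mod_cast hr
  set Q := empQuantile p y with hQ
  have hcount : ∀ (A : Finset (Fin r)) (t : ℝ), (∀ l ∈ A, t ^ 2 ≤ y l ^ 2) →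
      A.card * t ^ 2 ≤ ∑ l, y l ^ 2 := by
    intro A t h
    calc (A.card : ℝ) * t ^ 2 = ∑ _l ∈ A, t ^ 2 := by simp
      _ ≤ ∑ l ∈ A, y l ^ 2 := Finset.sum_le_sum h
      _ ≤ ∑ l, y l ^ 2 := Finset.sum_le_univ_sum_of_nonneg fun _ => sq_nonneg _
  rw [le_div_iff₀ hr']
  have hm0 : 0 < min p (1 - p) := lt_min hp.1 (by linarith [hp.2])
  have hS0 : 0 ≤ ∑ l, y l ^ 2 := by positivity
  rcases le_or_gt Q 0 with h0 | h0
  · have h1 := (empQuantile_le_iff hp hr y Q).1 le_rfl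
    have h2 := hcount (Finset.univ.filter fun l => y l ≤ Q) Q fun l hl => by
      have := (Finset.mem_filter.1 hl).2
      exact sq_le_sq.2 (by rw [abs_of_nonpos h0, abs_of_nonpos (this.trans h0)]; linarith)
    calc min p (1 - p) * Q ^ 2 * r ≤ p * Q ^ 2 * r := by gcongr; exact min_le_left _ _
      _ = p * r * Q ^ 2 := by ring
      _ ≤ _ := (mul_le_mul_of_nonneg_right h1 (sq_nonneg Q)).trans h2
  · have key : ∀ t, 0 ≤ t → t < Q → (1 - p) * r * t ^ 2 ≤ ∑ l, y l ^ 2 := by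
      intro t ht htQ
      have h1 := mt (empQuantile_le_iff hp hr y t).2 (not_le.2 htQ)
      rw [not_le] at h1
      have h2 := Finset.card_filter_add_card_filter_not (s := (Finset.univ : Finset (Fin r)))
        (fun l => y l ≤ t)
      rw [Finset.card_univ, Fintype.card_fin] at h2
      have h2' : ((Finset.univ.filter fun l => y l ≤ t).card : ℝ)
        + (Finset.univ.filter fun l => ¬ y l ≤ t).card = r := by exact_mod_cast h2
      have h3 := hcount (Finset.univ.filter fun l => ¬ y l ≤ t) t fun l hl => by
        have := not_le.1 (Finset.mem_filter.1 hl).2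
        exact pow_le_pow_left₀ ht this.le 2
      refine le_trans (mul_le_mul_of_nonneg_right ?_ (sq_nonneg t)) h3
      linarith
    have hlim : (1 - p) * r * Q ^ 2 ≤ ∑ l, y l ^ 2 := by
      have hc : Tendsto (fun t : ℝ => (1 - p) * r * t ^ 2) (𝓝[<] Q) (𝓝 ((1 - p) * r * Q ^ 2)) :=
        ((by fun_prop : Continuous fun t : ℝ => (1 - p) * r * t ^ 2).tendsto Q).mono_left
          nhdsWithin_le_nhds
      refine le_of_tendsto hc ?_
      filter_upwards [Ioo_mem_nhdsLT h0] with t ht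
      exact key t ht.1.le ht.2
    calc min p (1 - p) * Q ^ 2 * r ≤ (1 - p) * Q ^ 2 * r := by gcongr; exact min_le_right _ _
      _ = (1 - p) * r * Q ^ 2 := by ring
      _ ≤ _ := hlim

/-! ### Uniformly negligible families of events -/

section UnifNull

variable {Ω : Type*} [MeasurableSpace Ω] {μ : Measure Ω} {κ : ℕ → Type*}

/-- Families of events whose (outer) probabilities tend to zero uniformly over the family. -/
def UnifNull (μ : Measure Ω) (A : (n : ℕ) → κ n → Set Ω) : Prop :=
  Tendsto (fun n => ⨆ k, μ (A n k)) atTop (𝓝 0)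

lemma unifNull_iff {A : (n : ℕ) → κ n → Set Ω} :
    UnifNull μ A ↔ ∀ η : ℝ≥0∞, 0 < η → ∀ᶠ n in atTop, ∀ k, μ (A n k) ≤ η := by
  simp only [UnifNull, ENNReal.tendsto_nhds_zero, iSup_le_iff, gt_iff_lt]

lemma unifNull_iff_real {A : (n : ℕ) → κ n → Set Ω} :
    UnifNull μ A ↔ ∀ η : ℝ, 0 < η → ∀ᶠ n in atTop, ∀ k, μ (A n k) ≤ ENNReal.ofReal η := by
  rw [unifNull_iff]
  refine ⟨fun h η hη => h _ (ENNReal.ofReal_pos.2 hη), fun h η hη => ?_⟩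
  rcases eq_or_ne η ∞ with rfl | hη'
  · simp
  · rw [← ENNReal.ofReal_toReal hη']
    exact h _ (ENNReal.toReal_pos hη.ne' hη')

lemma UnifNull.mono {A B : (n : ℕ) → κ n → Set Ω} (hB : UnifNull μ B)
    (h : ∀ᶠ n in atTop, ∀ k, A n k ⊆ B n k) : UnifNull μ A := by
  rw [unifNull_iff] at hB ⊢
  intro η hη
  filter_upwards [hB η hη, h] with n h1 h2 k
  exact (measure_mono (h2 k)).trans (h1 k)

lemma UnifNull.mono_ae {A B : (n : ℕ) → κ n → Set Ω} (hB : UnifNull μ B)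
    (h : ∀ᶠ n in atTop, ∀ k, ∀ᵐ ω ∂μ, ω ∈ A n k → ω ∈ B n k) : UnifNull μ A := by
  rw [unifNull_iff] at hB ⊢
  intro η hη
  filter_upwards [hB η hη, h] with n h1 h2 k
  exact (measure_mono_ae (h2 k)).trans (h1 k)

lemma UnifNull.union {A B : (n : ℕ) → κ n → Set Ω} (hA : UnifNull μ A) (hB : UnifNull μ B) :
    UnifNull μ fun n k => A n k ∪ B n k := by
  rw [unifNull_iff] at *
  intro η hη
  filter_upwards [hA (η / 2) (ENNReal.half_pos hη.ne'), hB (η / 2) (ENNReal.half_pos hη.ne')]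
    with n h1 h2 k
  exact (measure_union_le _ _).trans ((add_le_add (h1 k) (h2 k)).trans_eq (ENNReal.add_halves η))

lemma ofReal_average {m : ℕ} (hm : 0 < m) {f : Fin m → ℝ} (hf : ∀ k, 0 ≤ f k) :
    ENNReal.ofReal ((∑ k, f k) / m) = (m : ℝ≥0∞)⁻¹ * ∑ k, ENNReal.ofReal (f k) := by
  have hm' : (0 : ℝ) < m := by exact_mod_cast hm
  rw [ENNReal.ofReal_div_of_pos hm', ENNReal.ofReal_sum_of_nonneg fun k _ => hf k,
    ENNReal.ofReal_natCast, div_eq_mul_inv, mul_comm]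

lemma unifNull_of_lintegral {X : (n : ℕ) → κ n → Ω → ℝ}
    (hX : ∀ n k, AEMeasurable (X n k) μ) {c : ℕ → ℝ≥0∞} (hc : Tendsto c atTop (𝓝 0))
    (h : ∀ᶠ n in atTop, ∀ k, ∫⁻ ω, ENNReal.ofReal (X n k ω) ∂μ ≤ c n) {ε : ℝ} (hε : 0 < ε) :
    UnifNull μ fun n k => {ω | ε ≤ X n k ω} := by
  rw [unifNull_iff]
  intro η hη
  have hε' : ENNReal.ofReal ε ≠ 0 := by simpa using hε
  have h0 : 0 < η * ENNReal.ofReal ε := ENNReal.mul_pos hη.ne' hε'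
  filter_upwards [h, (ENNReal.tendsto_nhds_zero.1 hc) _ h0] with n h1 h2 k
  have hsub : {ω | ε ≤ X n k ω} ⊆ {ω | ENNReal.ofReal ε ≤ ENNReal.ofReal (X n k ω)} :=
    fun ω hω => ENNReal.ofReal_le_ofReal hω
  refine (measure_mono hsub).trans ((meas_ge_le_lintegral_div (hX n k).ennreal_ofReal hε'
    ENNReal.ofReal_ne_top).trans ?_)
  exact ENNReal.div_le_of_le_mul (((h1 k).trans h2))

lemma tendstoInMeasure_const_iff {f : ℕ → Ω → ℝ} {c : ℝ} :
    TendstoInMeasure μ f atTop (fun _ => c) ↔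
      ∀ ε : ℝ, 0 < ε → UnifNull μ fun n (_ : Unit) => {ω | ε ≤ |f n ω - c|} := by
  simp only [tendstoInMeasure_iff_norm, Real.norm_eq_abs, UnifNull, iSup_const]

/-- Markov's inequality for averages over the subsets of a partition. -/
lemma tendstoInMeasure_average_zero {s : ℕ → ℕ} {X : (n : ℕ) → Fin (s n) → Ω → ℝ}
    (hX : ∀ n k, AEMeasurable (X n k) μ) (hX0 : ∀ n k ω, 0 ≤ X n k ω) {c : ℕ → ℝ≥0∞}
    (hc : Tendsto c atTop (𝓝 0))
    (h : ∀ᶠ n in atTop, ∀ k, ∫⁻ ω, ENNReal.ofReal (X n k ω) ∂μ ≤ c n) :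
    TendstoInMeasure μ (fun n ω => (∑ k, X n k ω) / s n) atTop (fun _ => (0 : ℝ)) := by
  rw [tendstoInMeasure_const_iff]
  intro ε hε
  have hnn : ∀ n ω, 0 ≤ (∑ k, X n k ω) / s n := fun n ω =>
    div_nonneg (Finset.sum_nonneg fun k _ => hX0 n k ω) (Nat.cast_nonneg _)
  simp only [sub_zero, abs_of_nonneg (hnn _ _)]
  refine unifNull_of_lintegral
    (fun n _ => (Finset.aemeasurable_fun_sum _ fun k _ => hX n k).div_const _) hc ?_ hε
  filter_upwards [h] with n hn _
  rcases Nat.eq_zero_or_pos (s n) with h0 | h0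
  · simp [h0]
  have h0' : (s n : ℝ≥0∞) ≠ 0 := by exact_mod_cast h0.ne'
  simp only [ofReal_average h0 (hX0 n · _)]
  have hXe (k) : AEMeasurable (fun ω => ENNReal.ofReal (X n k ω)) μ := (hX n k).ennreal_ofReal
  rw [lintegral_const_mul'' _ (Finset.aemeasurable_fun_sum _ fun k _ => hXe k),
    lintegral_finsetSum' _ fun k _ => hXe k]
  calc (s n : ℝ≥0∞)⁻¹ * ∑ k, ∫⁻ ω, ENNReal.ofReal (X n k ω) ∂μ
      ≤ (s n : ℝ≥0∞)⁻¹ * ∑ _k : Fin (s n), c n := by gcongr with k _; exact hn k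
    _ = c n := by
      rw [Finset.sum_const, Finset.card_univ, Fintype.card_fin, nsmul_eq_mul, ← mul_assoc,
        ENNReal.inv_mul_cancel h0' (by simp), one_mul]

/-- The proportion of uniformly negligible events that occur tends to zero in probability. -/
lemma UnifNull.tendstoInMeasure_proportion {s : ℕ → ℕ} {A : (n : ℕ) → Fin (s n) → Set Ω}
    (hA : UnifNull μ A) (hAm : ∀ n k, NullMeasurableSet (A n k) μ) :
    TendstoInMeasure μ (fun n ω => (∑ k, (A n k).indicator (1 : Ω → ℝ) ω) / s n) atTop
      (fun _ => (0 : ℝ)) := by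
  refine tendstoInMeasure_average_zero
    (X := fun n k ω => (A n k).indicator (1 : Ω → ℝ) ω)
    (fun n k => aemeasurable_one.indicator₀ (hAm n k))
    (fun n k ω => Set.indicator_nonneg (by simp) ω) hA (Eventually.of_forall fun n k => ?_)
  have : ∀ ω, ENNReal.ofReal ((A n k).indicator (1 : Ω → ℝ) ω)
      = (A n k).indicator (fun _ => (1 : ℝ≥0∞)) ω := by
    intro ω
    by_cases h : ω ∈ A n k <;> simp [h]
  simp only [this]
  rw [lintegral_indicator₀ (hAm n k), setLIntegral_one]
  exact le_iSup (fun k => μ (A n k)) k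

end UnifNull

/-! ### The law of the data of a subset -/

section Data

variable {Ω 𝒵 : Type*} [MeasurableSpace Ω] [MeasurableSpace 𝒵] {μ : Measure Ω}
  [IsProbabilityMeasure μ] {Z : ℕ → Ω → 𝒵} {s b : ℕ → ℕ}
  {I : (n : ℕ) → Ω → Fin (s n) → Fin (b n) → Fin n}

/-- The data of the block `k` of the partition `i`, as a function of the sample and of the
partition. -/
def selectBlock {n s b : ℕ} (k : Fin s) (d : (ℕ → 𝒵) × (Fin s → Fin b → Fin n)) : Fin b → 𝒵 :=
  fun a => d.1 (d.2 k a)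

lemma measurable_selectBlock {n s b : ℕ} (k : Fin s) :
    Measurable (selectBlock (𝒵 := 𝒵) (n := n) (b := b) k) := by
  refine measurable_from_prod_countable_left fun i => ?_
  exact measurable_pi_lambda _ fun a => measurable_pi_apply ((i k a : Fin n) : ℕ)

/-- The sample together with the partition into blocks. -/
def dataOf (Z : ℕ → Ω → 𝒵) (I : (n : ℕ) → Ω → Fin (s n) → Fin (b n) → Fin n) (n : ℕ) (ω : Ω) :
    (ℕ → 𝒵) × (Fin (s n) → Fin (b n) → Fin n) :=
  (fun i => Z i ω, I n ω)

lemma measurable_dataOf (hZ : ∀ i, Measurable (Z i)) (hI : ∀ n, Measurable (I n)) (n : ℕ) :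
    Measurable (dataOf Z I n) :=
  (measurable_pi_lambda _ hZ).prodMk (hI n)

lemma measurable_subsetData (hZ : ∀ i, Measurable (Z i)) (hI : ∀ n, Measurable (I n))
    (n : ℕ) (k : Fin (s n)) : Measurable (subsetData Z I n k) :=
  (measurable_selectBlock k).comp (measurable_dataOf hZ hI n)

/-- A block chosen independently of the sample consists of i.i.d. observations. -/
lemma map_subsetData (hZ : ∀ i, Measurable (Z i))
    (hZ_indep : iIndepFun Z μ) (hZ_ident : ∀ i, IdentDistrib (Z i) (Z 0) μ μ)
    (hI : ∀ n, Measurable (I n))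
    (hI_disj : ∀ n ω, Function.Injective fun p : Fin (s n) × Fin (b n) => I n ω p.1 p.2)
    (hI_indep : ∀ n, IndepFun (fun ω i => Z i ω) (I n) μ) (n : ℕ) (k : Fin (s n)) :
    μ.map (subsetData Z I n k) = Measure.pi fun _ => μ.map (Z 0) := by
  have : IsProbabilityMeasure (μ.map (Z 0)) :=
    Measure.isProbabilityMeasure_map (hZ 0).aemeasurable
  have hZs : Measurable fun ω i => Z i ω := measurable_pi_lambda _ hZ
  have : IsProbabilityMeasure (μ.map (fun ω i => Z i ω)) :=
    Measure.isProbabilityMeasure_map hZs.aemeasurable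
  have : IsProbabilityMeasure (μ.map (I n)) :=
    Measure.isProbabilityMeasure_map (hI n).aemeasurable
  have hprod : μ.map (dataOf Z I n) = (μ.map fun ω i => Z i ω).prod (μ.map (I n)) :=
    (indepFun_iff_map_prod_eq_prod_map_map hZs.aemeasurable (hI n).aemeasurable).1 (hI_indep n)
  have hfix : ∀ j : Fin (b n) → ℕ, Function.Injective j →
      μ.map (fun ω a => Z (j a) ω) = Measure.pi fun _ => μ.map (Z 0) := by
    intro j hj
    rw [(iIndepFun_iff_map_fun_eq_pi_map fun a => (hZ (j a)).aemeasurable).1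
      (hZ_indep.precomp hj)]
    congr 1
    ext1 a
    exact (hZ_ident (j a)).map_eq
  ext A hA
  have hAm : MeasurableSet (selectBlock (n := n) k ⁻¹' A) := measurable_selectBlock k hA
  have e : subsetData Z I n k = selectBlock k ∘ dataOf Z I n := rfl
  rw [e, ← Measure.map_map (measurable_selectBlock k) (measurable_dataOf hZ hI n),
    Measure.map_apply (measurable_selectBlock k) hA, hprod, Measure.prod_apply_symm hAm]
  have hae : ∀ᵐ i ∂(μ.map (I n)), Function.Injective (i k) := by
    rw [ae_map_iff (hI n).aemeasurable (Set.to_countable _).measurableSet]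
    refine ae_of_all _ fun ω a a' haa' => ?_
    have := hI_disj n ω (a₁ := (k, a)) (a₂ := (k, a')) haa'
    exact (Prod.ext_iff.1 this).2
  have : ∫⁻ i, (μ.map fun ω i => Z i ω) ((fun z => (z, i)) ⁻¹' (selectBlock (n := n) k ⁻¹' A))
      ∂(μ.map (I n)) = ∫⁻ _i, (Measure.pi fun _ => μ.map (Z 0)) A ∂(μ.map (I n)) := by
    refine lintegral_congr_ae ?_
    filter_upwards [hae] with i hi
    rw [← hfix (fun a => i k a) fun a a' h => hi (Fin.ext h),
      Measure.map_apply hZs (measurable_prodMk_right hAm), Measure.map_apply (by fun_prop) hA]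
    rfl
  rw [this]
  simp

/-- The data of a subset have the law of the first observations of the sample, which are listed
in a fixed order. -/
lemma lintegral_subsetData (hZ : ∀ i, Measurable (Z i))
    (hZ_indep : iIndepFun Z μ) (hZ_ident : ∀ i, IdentDistrib (Z i) (Z 0) μ μ)
    (hI : ∀ n, Measurable (I n))
    (hI_disj : ∀ n ω, Function.Injective fun p : Fin (s n) × Fin (b n) => I n ω p.1 p.2)
    (hI_indep : ∀ n, IndepFun (fun ω i => Z i ω) (I n) μ) (n : ℕ) (k : Fin (s n))
    {F : (Fin (b n) → 𝒵) → ℝ≥0∞} (hF : Measurable F) :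
    ∫⁻ ω, F (subsetData Z I n k ω) ∂μ = ∫⁻ ω, F (fun a => Z a ω) ∂μ := by
  have h1 := map_subsetData hZ hZ_indep hZ_ident hI hI_disj hI_indep n k
  have h2 : μ.map (fun ω (a : Fin (b n)) => Z a ω) = Measure.pi fun _ => μ.map (Z 0) := by
    rw [(iIndepFun_iff_map_fun_eq_pi_map fun a => (hZ _).aemeasurable).1
      (hZ_indep.precomp Fin.val_injective)]
    congr 1
    ext1 a
    exact (hZ_ident a).map_eq
  rw [← lintegral_map hF (measurable_subsetData hZ hI n k), h1, ← h2,
    lintegral_map hF (by fun_prop)]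

end Data

/-! ### Laws of large numbers in mean -/

section LLN

variable {Ω : Type*} [MeasurableSpace Ω] {μ : Measure Ω}
  {X : ℕ → Ω → ℝ}

lemma tendsto_lintegral_abs_average_sub (hX : Integrable (X 0) μ) (hindep : iIndepFun X μ)
    (hident : ∀ i, IdentDistrib (X i) (X 0) μ μ) :
    Tendsto (fun m : ℕ => ∫⁻ ω, ENNReal.ofReal |(∑ a : Fin m, X a ω) / m - ∫ ω, X 0 ω ∂μ| ∂μ)
      atTop (𝓝 0) := by
  have h := strong_law_Lp le_rfl (by simp) X (memLp_one_iff_integrable.2 hX)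
    (fun i j hij => hindep.indepFun hij) hident
  refine h.congr fun m => ?_
  rw [eLpNorm_one_eq_lintegral_enorm]
  refine lintegral_congr fun ω => ?_
  rw [Real.enorm_eq_ofReal_abs, Fin.sum_univ_eq_sum_range (fun a => X a ω), smul_eq_mul,
    inv_mul_eq_div]

lemma tendsto_lintegral_average_sq (hX : MemLp (X 0) 2 μ) (hindep : iIndepFun X μ)
    (hident : ∀ i, IdentDistrib (X i) (X 0) μ μ) (h0 : ∫ ω, X 0 ω ∂μ = 0) :
    Tendsto (fun m : ℕ => ∫⁻ ω, ENNReal.ofReal (((∑ a : Fin m, X a ω) / m) ^ 2) ∂μ)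
      atTop (𝓝 0) := by
  have h := strong_law_Lp one_le_two (by simp) X hX
    (fun i j hij => hindep.indepFun hij) hident
  have h2 := (ENNReal.continuous_pow 2).tendsto 0 |>.comp h
  simp only [ne_eq, OfNat.ofNat_ne_zero, not_false_eq_true, zero_pow] at h2
  refine h2.congr fun m => ?_
  have := eLpNorm_nnreal_pow_eq_lintegral (μ := μ) (p := 2)
    (f := fun ω => (m : ℝ)⁻¹ • (∑ i ∈ Finset.range m, X i ω) - ∫ ω, X 0 ω ∂μ) two_ne_zero
  simp only [NNReal.coe_ofNat, ENNReal.rpow_ofNat, ENNReal.coe_ofNat] at this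
  simp only [Function.comp_apply]
  rw [this]
  refine lintegral_congr fun ω => ?_
  rw [h0, Fin.sum_univ_eq_sum_range (fun a => X a ω), Real.enorm_eq_ofReal_abs,
    ← ENNReal.ofReal_pow (abs_nonneg _), sq_abs, smul_eq_mul, inv_mul_eq_div, sub_zero]

lemma lintegral_average_eq {g : ℝ → ℝ} (hg : Measurable g) (hg0 : ∀ t, 0 ≤ g t)
    (hident : ∀ i, IdentDistrib (X i) (X 0) μ μ) {m : ℕ} (hm : 0 < m) :
    ∫⁻ ω, ENNReal.ofReal ((∑ a : Fin m, g (X a ω)) / m) ∂μ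
      = ∫⁻ ω, ENNReal.ofReal (g (X 0 ω)) ∂μ := by
  have hm' : (m : ℝ≥0∞) ≠ 0 := by exact_mod_cast hm.ne'
  have hX (i) : AEMeasurable (X i) μ := (hident i).aemeasurable_fst
  simp only [ofReal_average hm fun _ => hg0 _]
  have hgm : Measurable fun t => ENNReal.ofReal (g t) := by fun_prop
  have hgX (i : Fin m) : AEMeasurable (fun ω => ENNReal.ofReal (g (X i ω))) μ :=
    hgm.comp_aemeasurable (hX _)
  rw [lintegral_const_mul'' _ (Finset.aemeasurable_fun_sum _ fun a _ => hgX a),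
    lintegral_finsetSum' _ (fun a _ => hgX a)]
  have h2 : ∀ a : Fin m, ∫⁻ ω, ENNReal.ofReal (g (X a ω)) ∂μ
      = ∫⁻ ω, ENNReal.ofReal (g (X 0 ω)) ∂μ := fun a =>
    ((hident a).comp hgm).lintegral_eq
  simp only [h2]
  rw [Finset.sum_const, Finset.card_univ, Fintype.card_fin, nsmul_eq_mul, ← mul_assoc,
    ENNReal.inv_mul_cancel hm' (by simp), one_mul]

lemma tendsto_lintegral_tail_sq {Y : Ω → ℝ} (hY : MemLp Y 2 μ) {c : ℕ → ℝ}
    (hc : Tendsto c atTop atTop) :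
    Tendsto (fun n => ∫⁻ ω, ENNReal.ofReal (if c n < |Y ω| then Y ω ^ 2 else 0) ∂μ)
      atTop (𝓝 0) := by
  have hm := hY.aestronglyMeasurable.aemeasurable
  have hgm (n) : Measurable fun t : ℝ => ENNReal.ofReal (if c n < |t| then t ^ 2 else 0) := by
    refine (Measurable.ite ?_ (by fun_prop) (by fun_prop)).ennreal_ofReal
    exact measurableSet_lt measurable_const (by fun_prop)
  have h := tendsto_lintegral_of_dominated_convergence' (μ := μ)
    (F := fun n ω => ENNReal.ofReal (if c n < |Y ω| then Y ω ^ 2 else 0)) (f := fun _ => 0)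
    (fun ω => ENNReal.ofReal (Y ω ^ 2)) (fun n => (hgm n).comp_aemeasurable hm)
    (fun n => ae_of_all _ fun ω => ENNReal.ofReal_le_ofReal (by
      split_ifs; exacts [le_rfl, sq_nonneg _]))
    (by
      have := hY.integrable_sq.lintegral_lt_top
      exact this.ne)
    (ae_of_all _ fun ω => by
      refine tendsto_const_nhds.congr' ?_
      filter_upwards [hc.eventually_ge_atTop |Y ω|] with n hn
      simp [not_lt.2 hn])
  simpa using h

end LLN

/-! ### Moments of the influence values within the subsets -/

/-- The sampling assumptions: i.i.d. data, and blocks without repetitions which are drawn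
independently of the data. -/
structure IsSubsampling {Ω 𝒵 : Type*} [MeasurableSpace Ω] [MeasurableSpace 𝒵] (μ : Measure Ω)
    (Z : ℕ → Ω → 𝒵) {s b : ℕ → ℕ} (I : (n : ℕ) → Ω → Fin (s n) → Fin (b n) → Fin n) : Prop where
  measurable_sample : ∀ i, Measurable (Z i)
  indep : iIndepFun Z μ
  ident : ∀ i, IdentDistrib (Z i) (Z 0) μ μ
  measurable_partition : ∀ n, Measurable (I n)
  injective : ∀ n ω, Function.Injective fun p : Fin (s n) × Fin (b n) => I n ω p.1 p.2
  indep_partition : ∀ n, IndepFun (fun ω i => Z i ω) (I n) μ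
  size_pos : ∀ n, 0 < b n
  tendsto_size : Tendsto b atTop atTop

/-- A centred, square integrable influence function. -/
structure IsInfluence {Ω 𝒵 : Type*} [MeasurableSpace Ω] [MeasurableSpace 𝒵] (μ : Measure Ω)
    (Z : ℕ → Ω → 𝒵) (ψ : 𝒵 → ℝ) : Prop where
  measurable : Measurable ψ
  memLp : MemLp ψ 2 (μ.map (Z 0))
  integral_eq_zero : ∫ z, ψ z ∂(μ.map (Z 0)) = 0

section Moments

variable {Ω 𝒵 : Type*} [MeasurableSpace Ω] [MeasurableSpace 𝒵] {μ : Measure Ω}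
  {Z : ℕ → Ω → 𝒵} {s b : ℕ → ℕ}
  {I : (n : ℕ) → Ω → Fin (s n) → Fin (b n) → Fin n} {ψ : 𝒵 → ℝ}

lemma IsSubsampling.measurable_subsetData (hS : IsSubsampling μ Z I) (n : ℕ) (k : Fin (s n)) :
    Measurable (subsetData Z I n k) :=
  CBLB.measurable_subsetData hS.measurable_sample hS.measurable_partition n k

lemma IsInfluence.memLp_comp (hψ : IsInfluence μ Z ψ) (hS : IsSubsampling μ Z I) :
    MemLp (fun ω => ψ (Z 0 ω)) 2 μ :=
  hψ.memLp.comp_of_map (hS.measurable_sample 0).aemeasurable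

lemma IsInfluence.integral_comp (hψ : IsInfluence μ Z ψ) (hS : IsSubsampling μ Z I) :
    ∫ ω, ψ (Z 0 ω) ∂μ = 0 := by
  rw [← hψ.integral_eq_zero, integral_map (hS.measurable_sample 0).aemeasurable
    hψ.measurable.aestronglyMeasurable]

lemma IsInfluence.variance_eq (hψ : IsInfluence μ Z ψ) (hS : IsSubsampling μ Z I) :
    Var[ψ; μ.map (Z 0)] = ∫ ω, ψ (Z 0 ω) ^ 2 ∂μ := by
  rw [variance_eq_integral hψ.measurable.aemeasurable, hψ.integral_eq_zero,
    integral_map (hS.measurable_sample 0).aemeasurable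
      (((hψ.measurable.sub_const 0).pow_const 2).aestronglyMeasurable)]
  simp

variable [IsProbabilityMeasure μ]

lemma IsSubsampling.lintegral_eq (hS : IsSubsampling μ Z I) (n : ℕ) (k : Fin (s n))
    {F : (Fin (b n) → 𝒵) → ℝ≥0∞} (hF : Measurable F) :
    ∫⁻ ω, F (subsetData Z I n k ω) ∂μ = ∫⁻ ω, F (fun a => Z a ω) ∂μ :=
  lintegral_subsetData hS.measurable_sample hS.indep hS.ident hS.measurable_partition hS.injective
    hS.indep_partition n k hF

lemma tendsto_lintegral_subset_sq (hS : IsSubsampling μ Z I) (hψ : IsInfluence μ Z ψ) :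
    ∃ c : ℕ → ℝ≥0∞, Tendsto c atTop (𝓝 0) ∧ ∀ n k,
      ∫⁻ ω, ENNReal.ofReal
        |(∑ a, ψ (subsetData Z I n k ω a) ^ 2) / b n - Var[ψ; μ.map (Z 0)]| ∂μ = c n := by
  have hψm := hψ.measurable
  have h := tendsto_lintegral_abs_average_sub (μ := μ) (X := fun i ω => ψ (Z i ω) ^ 2)
    (hψ.memLp_comp hS).integrable_sq
    (hS.indep.comp (fun _ z => ψ z ^ 2) fun _ => by fun_prop)
    (fun i => (hS.ident i).comp (u := fun z => ψ z ^ 2) (by fun_prop))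
  refine ⟨_, h.comp hS.tendsto_size, fun n k => ?_⟩
  rw [hS.lintegral_eq n k (F := fun z => ENNReal.ofReal
        |(∑ a, ψ (z a) ^ 2) / b n - Var[ψ; μ.map (Z 0)]|) (by fun_prop), hψ.variance_eq hS]
  rfl

lemma tendsto_lintegral_subset_empMean_sq (hS : IsSubsampling μ Z I) (hψ : IsInfluence μ Z ψ) :
    ∃ c : ℕ → ℝ≥0∞, Tendsto c atTop (𝓝 0) ∧ ∀ n k,
      ∫⁻ ω, ENNReal.ofReal (empMean (fun a => ψ (subsetData Z I n k ω a)) ^ 2) ∂μ = c n := by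
  have hψm := hψ.measurable
  have h := tendsto_lintegral_average_sq (μ := μ) (X := fun i ω => ψ (Z i ω))
    (hψ.memLp_comp hS) (hS.indep.comp (fun _ z => ψ z) fun _ => by fun_prop)
    (fun i => (hS.ident i).comp (u := fun z => ψ z) (by fun_prop)) (hψ.integral_comp hS)
  refine ⟨_, h.comp hS.tendsto_size, fun n k => ?_⟩
  have hm := measurable_empMean (b := b n)
  rw [hS.lintegral_eq n k (F := fun z => ENNReal.ofReal (empMean (fun a => ψ (z a)) ^ 2))
    (by fun_prop)]
  rfl

lemma measurable_ite_abs_sq (c : ℝ) : Measurable fun t : ℝ => if c < |t| then t ^ 2 else 0 :=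
  Measurable.ite (measurableSet_lt measurable_const (by fun_prop)) (by fun_prop) (by fun_prop)

lemma tendsto_lintegral_subset_tail (hS : IsSubsampling μ Z I) (hψ : IsInfluence μ Z ψ)
    {d : ℕ → ℝ} (hd : Tendsto d atTop atTop) :
    ∃ c : ℕ → ℝ≥0∞, Tendsto c atTop (𝓝 0) ∧ ∀ n k,
      ∫⁻ ω, ENNReal.ofReal ((∑ a, if d n < |ψ (subsetData Z I n k ω a)| then
        ψ (subsetData Z I n k ω a) ^ 2 else 0) / b n) ∂μ = c n := by
  have hψm := hψ.measurable
  refine ⟨_, tendsto_lintegral_tail_sq (hψ.memLp_comp hS) hd, fun n k => ?_⟩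
  have hg := measurable_ite_abs_sq (d n)
  rw [hS.lintegral_eq n k (F := fun z => ENNReal.ofReal ((∑ a, if d n < |ψ (z a)| then
        ψ (z a) ^ 2 else 0) / b n)) ?_]
  · exact lintegral_average_eq (X := fun i ω => ψ (Z i ω)) hg
      (fun t => by split_ifs <;> positivity)
      (fun i => (hS.ident i).comp (u := fun z => ψ z) (by fun_prop)) (hS.size_pos n)
  · refine (Measurable.div_const (Finset.measurable_fun_sum _ fun a _ => ?_) _).ennreal_ofReal
    exact hg.comp (by fun_prop : Measurable fun z : Fin (b n) → 𝒵 => ψ (z a))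

end Moments

/-! ### The contributions of a subset -/

section Contributions

variable {Ω 𝒵 : Type*} [MeasurableSpace Ω] [MeasurableSpace 𝒵] {μ : Measure Ω}
  [IsProbabilityMeasure μ] {Z : ℕ → Ω → 𝒵} {s b : ℕ → ℕ}
  {I : (n : ℕ) → Ω → Fin (s n) → Fin (b n) → Fin n} {ψ : 𝒵 → ℝ}
  {fit : (n : ℕ) → (Fin (b n) → 𝒵) → Fin (b n) → ℝ} {θ₀ : ℝ}

omit [MeasurableSpace Ω] [MeasurableSpace 𝒵] in
lemma contrib_eq (n : ℕ) (k : Fin (s n)) (ω : Ω) :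
    contrib Z I fit n k ω = fun a => θ₀ + (ψ (subsetData Z I n k ω a)
      + remainder Z I fit θ₀ ψ n k ω a) := by
  ext a
  rw [remainder]
  ring

omit [MeasurableSpace Ω] [MeasurableSpace 𝒵] in
/-- The empirical variance of the contributions is close to the empirical second moment of the
influence values. -/
lemma abs_empVar_contrib_sub_le (hb : ∀ n, 0 < b n) (n : ℕ) (k : Fin (s n)) (ω : Ω) {η : ℝ}
    (hη : 0 < η) :
    |empVar (contrib Z I fit n k ω) - (∑ a, ψ (subsetData Z I n k ω a) ^ 2) / b n|
      ≤ η * ((∑ a, ψ (subsetData Z I n k ω a) ^ 2) / b n)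
        + (3 + η⁻¹) * ((∑ a, remainder Z I fit θ₀ ψ n k ω a ^ 2) / b n)
        + 2 * empMean (fun a => ψ (subsetData Z I n k ω a)) ^ 2 := by
  rw [contrib_eq (θ₀ := θ₀) (ψ := ψ) n k ω, empVar_const_add (hb n)]
  exact abs_empVar_add_sub_le (hb n) _ _ hη

omit [IsProbabilityMeasure μ] in
lemma measurable_contrib (hS : IsSubsampling μ Z I) (hfit : ∀ n, Measurable (fit n)) (n : ℕ)
    (k : Fin (s n)) : Measurable (contrib Z I fit n k) :=
  (hfit n).comp (hS.measurable_subsetData n k)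

/-- The lists of contributions satisfy the hypotheses of the uniform central limit theorem with
probability tending to one, uniformly over the subsets. -/
lemma unifNull_contrib_notMem_cltSet (hS : IsSubsampling μ Z I) (hψ : IsInfluence μ Z ψ)
    (h_rem_sq : SubsetLittleOp μ s fun (n : ℕ) k ω =>
      (∑ a, remainder Z I fit θ₀ ψ n k ω a ^ 2) / b n) {δ : ℝ} (hδ : 0 < δ) :
    UnifNull μ fun n k =>
      {ω | contrib Z I fit n k ω ∉ cltSet (b n) Var[ψ; μ.map (Z 0)] δ n} := by
  set V := Var[ψ; μ.map (Z 0)] with hV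
  have hV0 : 0 ≤ V := variance_nonneg _ _
  have hψm := hψ.measurable
  have hDm := hS.measurable_subsetData
  obtain ⟨η, hη, hηδ⟩ : ∃ η > 0, η * (V + 1) = δ / 2 :=
    ⟨δ / 2 / (V + 1), by positivity, by field_simp⟩
  obtain ⟨ρ, hρ, hρ1, hρδ⟩ : ∃ ρ > 0, ρ ≤ 1 ∧ (36 + η⁻¹) * ρ ≤ δ / 2 := by
    refine ⟨min 1 (δ / 2 / (36 + η⁻¹)), by positivity, min_le_left _ _, ?_⟩
    calc (36 + η⁻¹) * min 1 (δ / 2 / (36 + η⁻¹)) ≤ (36 + η⁻¹) * (δ / 2 / (36 + η⁻¹)) := by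
          gcongr; exact min_le_right _ _
      _ = δ / 2 := by field_simp
  obtain ⟨c₁, hc₁, h₁⟩ := tendsto_lintegral_subset_sq hS hψ
  obtain ⟨c₂, hc₂, h₂⟩ := tendsto_lintegral_subset_empMean_sq hS hψ
  have hd : Tendsto (fun n : ℕ => δ * √(n : ℝ) / 4) atTop atTop :=
    ((Real.tendsto_sqrt_atTop.comp tendsto_natCast_atTop_atTop).const_mul_atTop hδ).atTop_div_const
      (by norm_num)
  obtain ⟨c₃, hc₃, h₃⟩ := tendsto_lintegral_subset_tail hS hψ hd
  have u₁ := unifNull_of_lintegral (fun n k => by have := hDm n k; fun_prop) hc₁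
    (Eventually.of_forall fun n k => (h₁ n k).le) hρ
  have u₂ := unifNull_of_lintegral
    (fun n k => by have := hDm n k; have := measurable_empMean (b := b n); fun_prop) hc₂
    (Eventually.of_forall fun n k => (h₂ n k).le) hρ
  have u₃ := unifNull_of_lintegral
    (fun n k => (Measurable.div_const (Finset.measurable_fun_sum _ fun a _ =>
      (measurable_ite_abs_sq (δ * √(n : ℝ) / 4)).comp (by have := hDm n k; fun_prop :
        Measurable fun ω => ψ (subsetData Z I n k ω a))) _).aemeasurable) hc₃
    (Eventually.of_forall fun n k => (h₃ n k).le) hρ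
  have u₄ : UnifNull μ fun (n : ℕ) (k : Fin (s n)) =>
    {ω | ρ ≤ |(∑ a, remainder Z I fit θ₀ ψ n k ω a ^ 2) / b n|} := h_rem_sq ρ hρ
  refine (((u₁.union u₂).union u₃).union u₄).mono (Eventually.of_forall fun n k ω hω => ?_)
  by_contra hcon
  simp only [Set.mem_union, Set.mem_ofPred_eq, not_or, not_le] at hcon
  obtain ⟨⟨⟨g₁, g₂⟩, g₃⟩, g₄⟩ := hcon
  refine hω ?_
  have g₄' := (le_abs_self _).trans_lt g₄
  have hR0 : 0 ≤ (∑ a, remainder Z I fit θ₀ ψ n k ω a ^ 2) / b n := by positivity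
  have hη' : 0 < η⁻¹ := inv_pos.2 hη
  constructor
  · have e := abs_empVar_contrib_sub_le (fit := fit) (θ₀ := θ₀) (ψ := ψ) (Z := Z) (I := I)
      hS.size_pos n k ω hη
    have e2 := abs_sub_le (empVar (contrib Z I fit n k ω))
      ((∑ a, ψ (subsetData Z I n k ω a) ^ 2) / b n) V
    have e3 : (∑ a, ψ (subsetData Z I n k ω a) ^ 2) / b n ≤ V + 1 := by
      linarith [(abs_lt.1 g₁).2]
    have e4 : η * ((∑ a, ψ (subsetData Z I n k ω a) ^ 2) / b n) ≤ η * (V + 1) := by gcongr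
    have e5 : (3 + η⁻¹) * ((∑ a, remainder Z I fit θ₀ ψ n k ω a ^ 2) / b n)
        ≤ (3 + η⁻¹) * ρ := by gcongr
    nlinarith
  · rw [contrib_eq (θ₀ := θ₀) (ψ := ψ) n k ω, lindTail_const_add (hS.size_pos n)]
    have e := lindTail_add_le (hS.size_pos n) (fun a => ψ (subsetData Z I n k ω a))
      (remainder Z I fit θ₀ ψ n k ω) (δ * √(n : ℝ))
    have : 0 < η⁻¹ * ρ := by positivity
    simp only [Function.comp_apply] at g₃
    nlinarith

/-- The proportion of subsets whose empirical variance is away from the asymptotic variance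
vanishes. -/
lemma tendstoInMeasure_card_empVar (hS : IsSubsampling μ Z I) (hψ : IsInfluence μ Z ψ)
    (hfit : ∀ n, Measurable (fit n))
    (h_rem_sq : SubsetLittleOp μ s fun (n : ℕ) k ω =>
      (∑ a, remainder Z I fit θ₀ ψ n k ω a ^ 2) / b n) {ε : ℝ} (hε : 0 < ε) :
    TendstoInMeasure μ
      (fun n ω => ((Finset.univ.filter fun k : Fin (s n) =>
          ε < |empVar (contrib Z I fit n k ω) - Var[ψ; μ.map (Z 0)]|).card : ℝ) / s n)
      atTop (fun _ => (0 : ℝ)) := by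
  set V := Var[ψ; μ.map (Z 0)] with hV
  have hnull : UnifNull μ fun n k => {ω | ε < |empVar (contrib Z I fit n k ω) - V|} :=
    (unifNull_contrib_notMem_cltSet hS hψ h_rem_sq hε).mono
      (Eventually.of_forall fun n k ω hω hmem => not_le.2 hω hmem.1)
  have h := hnull.tendstoInMeasure_proportion fun n k => by
    have h1 := measurable_contrib hS hfit n k
    have h2 := measurable_empVar (b := b n)
    exact (measurableSet_lt measurable_const ((h2.comp h1).sub_const V).abs).nullMeasurableSet
  refine h.congr_left fun n => ae_of_all _ fun ω => ?_
  dsimp only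
  rw [Finset.card_filter]
  push_cast
  congr 1

lemma tendstoInMeasure_average_empVar (hS : IsSubsampling μ Z I) (hψ : IsInfluence μ Z ψ)
    (hs : ∀ᶠ n in atTop, 0 < s n)
    (h_avg : TendstoInMeasure μ (fun n ω => (∑ k : Fin (s n),
        (∑ a, remainder Z I fit θ₀ ψ n k ω a ^ 2) / b n) / s n) atTop (fun _ => (0 : ℝ))) :
    TendstoInMeasure μ
      (fun n ω => (∑ k : Fin (s n), empVar (contrib Z I fit n k ω)) / s n)
      atTop (fun _ => Var[ψ; μ.map (Z 0)]) := by
  set V := Var[ψ; μ.map (Z 0)] with hV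
  have hV0 : 0 ≤ V := variance_nonneg _ _
  have hψm := hψ.measurable
  have hDm := hS.measurable_subsetData
  obtain ⟨c₁, hc₁, h₁⟩ := tendsto_lintegral_subset_sq hS hψ
  obtain ⟨c₂, hc₂, h₂⟩ := tendsto_lintegral_subset_empMean_sq hS hψ
  have a₁ := tendstoInMeasure_average_zero (μ := μ)
    (X := fun n k ω => |(∑ a, ψ (subsetData Z I n k ω a) ^ 2) / b n - V|)
    (fun n k => by have := hDm n k; fun_prop) (fun n k ω => abs_nonneg _) hc₁
    (Eventually.of_forall fun n k => (h₁ n k).le)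
  have a₂ := tendstoInMeasure_average_zero (μ := μ)
    (X := fun n k ω => empMean (fun a => ψ (subsetData Z I n k ω a)) ^ 2)
    (fun n k => by have := hDm n k; have := measurable_empMean (b := b n); fun_prop)
    (fun n k ω => sq_nonneg _) hc₂ (Eventually.of_forall fun n k => (h₂ n k).le)
  rw [tendstoInMeasure_const_iff] at a₁ a₂ h_avg ⊢
  intro ε hε
  obtain ⟨η, hη, hηε⟩ : ∃ η > 0, η * (V + 1) = ε / 4 :=
    ⟨ε / 4 / (V + 1), by positivity, by field_simp⟩
  obtain ⟨ρ, hρ, hρ1, hρε⟩ : ∃ ρ > 0, ρ ≤ 1 ∧ (6 + η⁻¹) * ρ ≤ ε / 2 := by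
    refine ⟨min 1 (ε / 2 / (6 + η⁻¹)), by positivity, min_le_left _ _, ?_⟩
    calc (6 + η⁻¹) * min 1 (ε / 2 / (6 + η⁻¹)) ≤ (6 + η⁻¹) * (ε / 2 / (6 + η⁻¹)) := by
          gcongr; exact min_le_right _ _
      _ = ε / 2 := by field_simp
  refine (((a₁ ρ hρ).union (a₂ ρ hρ)).union (h_avg ρ hρ)).mono ?_
  filter_upwards [hs] with n hsn _ ω hω
  by_contra hcon
  simp only [Set.mem_union, Set.mem_ofPred_eq, not_or, not_le, sub_zero] at hcon
  obtain ⟨⟨g₁, g₂⟩, g₃⟩ := hcon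
  refine (not_le.2 ?_) (show ε ≤ _ from hω)
  have hsn' : (0 : ℝ) < s n := by exact_mod_cast hsn
  have g₁' := (le_abs_self _).trans_lt g₁
  have g₂' := (le_abs_self _).trans_lt g₂
  have g₃' := (le_abs_self _).trans_lt g₃
  have hη' : 0 < η⁻¹ := inv_pos.2 hη
  have e0 : (∑ k : Fin (s n), empVar (contrib Z I fit n k ω)) / s n - V
      = (∑ k : Fin (s n), (empVar (contrib Z I fit n k ω) - V)) / s n := by
    rw [Finset.sum_sub_distrib, Finset.sum_const, Finset.card_univ, Fintype.card_fin,
      nsmul_eq_mul]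
    field_simp
  have e1 : ∀ k : Fin (s n), |empVar (contrib Z I fit n k ω) - V|
      ≤ (1 + η) * |(∑ a, ψ (subsetData Z I n k ω a) ^ 2) / b n - V| + η * V
        + (3 + η⁻¹) * ((∑ a, remainder Z I fit θ₀ ψ n k ω a ^ 2) / b n)
        + 2 * empMean (fun a => ψ (subsetData Z I n k ω a)) ^ 2 := by
    intro k
    have e := abs_empVar_contrib_sub_le (fit := fit) (θ₀ := θ₀) (ψ := ψ) (Z := Z) (I := I)
      hS.size_pos n k ω hη
    have e2 := abs_sub_le (empVar (contrib Z I fit n k ω))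
      ((∑ a, ψ (subsetData Z I n k ω a) ^ 2) / b n) V
    have e3 := le_abs_self ((∑ a, ψ (subsetData Z I n k ω a) ^ 2) / b n - V)
    nlinarith
  calc |(∑ k : Fin (s n), empVar (contrib Z I fit n k ω)) / s n - V|
      ≤ (∑ k : Fin (s n), |empVar (contrib Z I fit n k ω) - V|) / s n := by
        rw [e0, abs_div, abs_of_pos hsn']
        gcongr
        exact Finset.abs_sum_le_sum_abs _ _
    _ ≤ (∑ k : Fin (s n), ((1 + η) * |(∑ a, ψ (subsetData Z I n k ω a) ^ 2) / b n - V| + η * V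
        + (3 + η⁻¹) * ((∑ a, remainder Z I fit θ₀ ψ n k ω a ^ 2) / b n)
        + 2 * empMean (fun a => ψ (subsetData Z I n k ω a)) ^ 2)) / s n := by
        gcongr with k _
        exact e1 k
    _ = (1 + η) * ((∑ k : Fin (s n), |(∑ a, ψ (subsetData Z I n k ω a) ^ 2) / b n - V|) / s n)
        + η * V + (3 + η⁻¹) * ((∑ k : Fin (s n),
          (∑ a, remainder Z I fit θ₀ ψ n k ω a ^ 2) / b n) / s n)
        + 2 * ((∑ k : Fin (s n), empMean (fun a => ψ (subsetData Z I n k ω a)) ^ 2) / s n) := by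
        simp only [Finset.sum_add_distrib, ← Finset.mul_sum, Finset.sum_const, Finset.card_univ,
          Fintype.card_fin, nsmul_eq_mul]
        field_simp
    _ ≤ (1 + η) * ρ + η * V + (3 + η⁻¹) * ρ + 2 * ρ := by gcongr
    _ < ε := by nlinarith

end Contributions

/-! ### The conditional law of the bootstrap replicates -/

section Fubini

variable {Ω α β : Type*} [MeasurableSpace Ω] [MeasurableSpace α] [MeasurableSpace β]
  {μ : Measure Ω} [IsProbabilityMeasure μ] {D : Ω → α} {W : Ω → β}

lemma lintegral_prod_of_indepFun (h : IndepFun D W μ) (hD : Measurable D) (hW : AEMeasurable W μ)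
    {F : α × β → ℝ≥0∞} (hF : Measurable F) :
    ∫⁻ ω, F (D ω, W ω) ∂μ = ∫⁻ ω, ∫⁻ w, F (D ω, w) ∂(μ.map W) ∂μ := by
  have : IsProbabilityMeasure (μ.map W) := Measure.isProbabilityMeasure_map hW
  have e := (indepFun_iff_map_prod_eq_prod_map_map hD.aemeasurable hW).1 h
  rw [← lintegral_map' (g := fun ω => (D ω, W ω)) hF.aemeasurable (hD.aemeasurable.prodMk hW), e,
    lintegral_prod _ hF.aemeasurable, lintegral_map hF.lintegral_prod_right' hD]

/-- A bound on the conditional probabilities of a family of events carries over to the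
unconditional probability. -/
lemma measure_le_of_indepFun (h : IndepFun D W μ) (hD : Measurable D) (hW : AEMeasurable W μ)
    {S : Set (α × β)} (hS : MeasurableSet S) {c : ℝ≥0∞}
    (hc : ∀ d, μ {ω | (d, W ω) ∈ S} ≤ c) : μ {ω | (D ω, W ω) ∈ S} ≤ c := by
  have h1 := lintegral_prod_of_indepFun h hD hW (F := S.indicator fun _ => 1)
    (measurable_const.indicator hS)
  have h2 : ∫⁻ ω, S.indicator (fun _ => (1 : ℝ≥0∞)) (D ω, W ω) ∂μ = μ {ω | (D ω, W ω) ∈ S} := by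
    have : NullMeasurableSet {ω | (D ω, W ω) ∈ S} μ :=
      (hD.aemeasurable.prodMk hW).nullMeasurable hS
    rw [← lintegral_indicator_one₀ this]
    rfl
  rw [← h2, h1]
  have h3 : ∀ d, ∫⁻ w, S.indicator (fun _ => (1 : ℝ≥0∞)) (d, w) ∂(μ.map W) ≤ c := by
    intro d
    have hm : MeasurableSet {w | (d, w) ∈ S} := measurable_prodMk_left hS
    have : ∫⁻ w, S.indicator (fun _ => (1 : ℝ≥0∞)) (d, w) ∂(μ.map W)
        = (μ.map W) {w | (d, w) ∈ S} := by
      rw [← lintegral_indicator_one hm]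
      rfl
    rw [this, Measure.map_apply_of_aemeasurable hW hm]
    exact hc d
  calc ∫⁻ ω, ∫⁻ w, S.indicator (fun _ => (1 : ℝ≥0∞)) (D ω, w) ∂(μ.map W) ∂μ
      ≤ ∫⁻ _ω, c ∂μ := lintegral_mono fun ω => h3 _
    _ = c := by simp

/-- The conditional distribution of `g (D, W)` given `D`, when `W` is independent of `D`, is
obtained by freezing `D`. -/
lemma condDistrib_of_indepFun {γ : Type*} [MeasurableSpace γ] [StandardBorelSpace γ] [Nonempty γ]
    (h : IndepFun D W μ) (hD : Measurable D)
    (hW : AEMeasurable W μ) {g : α × β → γ} (hg : Measurable g) :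
    ∀ᵐ ω ∂μ, condDistrib (fun ω => g (D ω, W ω)) D μ (D ω)
      = (μ.map W).map fun w => g (D ω, w) := by
  have : IsProbabilityMeasure (μ.map W) := Measure.isProbabilityMeasure_map hW
  set κ : Kernel α γ := (Kernel.id ×ₖ Kernel.const α (μ.map W)).map g with hκ
  have : IsMarkovKernel κ := Kernel.IsMarkovKernel.map _ hg
  have hκx : ∀ x, κ x = (μ.map W).map fun w => g (x, w) := by
    intro x
    rw [hκ, Kernel.map_apply _ hg, Kernel.prod_apply, Kernel.id_apply, Kernel.const_apply,
      Measure.dirac_prod, Measure.map_map hg (by fun_prop)]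
    rfl
  have hY : AEMeasurable (fun ω => g (D ω, W ω)) μ :=
    hg.comp_aemeasurable (hD.aemeasurable.prodMk hW)
  have hjoint : μ.map (fun ω => (D ω, g (D ω, W ω))) = μ.map D ⊗ₘ κ := by
    refine Measure.ext_of_lintegral _ fun f hf => ?_
    rw [lintegral_map' hf.aemeasurable (hD.aemeasurable.prodMk hY), Measure.lintegral_compProd hf,
      lintegral_map hf.lintegral_kernel_prod_right' hD,
      lintegral_prod_of_indepFun h hD hW (F := fun p => f (p.1, g p)) (by fun_prop)]
    refine lintegral_congr fun ω => ?_
    have hgω : Measurable fun w => g (D ω, w) := by fun_prop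
    rw [hκx, lintegral_map (f := fun t => f (D ω, t)) (by fun_prop) hgω]
  have := condDistrib_ae_eq_of_measure_eq_compProd D hY hjoint
  filter_upwards [ae_of_ae_map hD.aemeasurable this] with ω hω
  rw [hω, hκx]

end Fubini

/-- The resampling assumptions: the count vectors of the replicates are independent multinomial
vectors, and independent of the data and of the partition. -/
structure IsResampling {Ω 𝒵 : Type*} [MeasurableSpace Ω] [MeasurableSpace 𝒵] (μ : Measure Ω)
    (Z : ℕ → Ω → 𝒵) {s b : ℕ → ℕ} (I : (n : ℕ) → Ω → Fin (s n) → Fin (b n) → Fin n)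
    (M : (n : ℕ) → Fin (s n) → ℕ → Ω → Fin (b n) → ℕ) : Prop where
  law : ∀ n k l, HasLaw (M n k l) (unifMultinomial n (b n)) μ
  indep : ∀ n, iIndepFun (fun (kl : Fin (s n) × ℕ) => M n kl.1 kl.2) μ
  indep_data : ∀ n, IndepFun (dataOf Z I n) (fun ω (kl : Fin (s n) × ℕ) => M n kl.1 kl.2 ω) μ

section Replicates

lemma subsetLittleOp_iff {Ω : Type*} [MeasurableSpace Ω] {μ : Measure Ω} {s : ℕ → ℕ}
    {X : (n : ℕ) → Fin (s n) → Ω → ℝ} :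
    SubsetLittleOp μ s X ↔ ∀ ε : ℝ, 0 < ε → UnifNull μ fun n k => {ω | ε ≤ |X n k ω|} :=
  Iff.rfl


variable {Ω 𝒵 : Type*} [MeasurableSpace Ω] [MeasurableSpace 𝒵] {μ : Measure Ω}
  [IsProbabilityMeasure μ] {Z : ℕ → Ω → 𝒵} {s b : ℕ → ℕ}
  {I : (n : ℕ) → Ω → Fin (s n) → Fin (b n) → Fin n}
  {fit : (n : ℕ) → (Fin (b n) → 𝒵) → Fin (b n) → ℝ}
  {M : (n : ℕ) → Fin (s n) → ℕ → Ω → Fin (b n) → ℕ}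
  {ψ : 𝒵 → ℝ} {θ₀ : ℝ}

lemma measurable_bootRoot_comp {α : Type*} [MeasurableSpace α] {m : ℕ} (n : ℕ)
    {f : α → Fin m → ℝ} (hf : Measurable f) :
    Measurable fun p : α × (Fin m → ℕ) => bootRoot n (f p.1) p.2 :=
  (measurable_bootRoot n).comp (f := fun p : α × (Fin m → ℕ) => (f p.1, p.2))
    ((hf.comp measurable_fst).prodMk measurable_snd)

omit [IsProbabilityMeasure μ] in
lemma IsResampling.indepFun_dataOf (hR : IsResampling μ Z I M) {n : ℕ} (k : Fin (s n)) (l : ℕ) :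
    IndepFun (dataOf Z I n) (M n k l) μ := by
  have h : Measurable fun m : Fin (s n) × ℕ → Fin (b n) → ℕ => m (k, l) := measurable_pi_apply _
  exact (hR.indep_data n).comp measurable_id h

omit [IsProbabilityMeasure μ] in
lemma IsResampling.indepFun_subsetData (hR : IsResampling μ Z I M) {n : ℕ} (k : Fin (s n))
    (l : ℕ) : IndepFun (subsetData Z I n k) (M n k l) μ :=
  (hR.indepFun_dataOf k l).comp (measurable_selectBlock k) measurable_id

/-- The bootstrap replicates are conditionally asymptotically normal given the data of the subset,
uniformly over the subsets. -/
lemma tendsto_levyProkhorovDist_replicate (hS : IsSubsampling μ Z I) (hψ : IsInfluence μ Z ψ)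
    (hfit : ∀ n, Measurable (fit n))
    (hR : IsResampling μ Z I M)
    (h_rem_sq : SubsetLittleOp μ s fun (n : ℕ) k ω =>
      (∑ a, remainder Z I fit θ₀ ψ n k ω a ^ 2) / b n) (l : ℕ) :
    SubsetLittleOp μ s fun (n : ℕ) k ω =>
      levyProkhorovDist
        (condDistrib
          (fun ω' => √(n : ℝ) * (bootReplicate Z I fit M n k l ω'
            - empMean (contrib Z I fit n k ω')))
          (subsetData Z I n k) μ (subsetData Z I n k ω))
        (gaussianReal 0 (empVar (contrib Z I fit n k ω)).toNNReal) := by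
  rw [subsetLittleOp_iff]
  intro ε hε
  obtain ⟨δ, hδ, hclt⟩ := exists_forall_levyProkhorovDist_bootLaw_empVar_lt
    (variance_nonneg ψ (μ.map (Z 0))) hε
  refine (unifNull_contrib_notMem_cltSet hS hψ h_rem_sq hδ).mono_ae ?_
  filter_upwards [hclt] with n hn k
  have hind : IndepFun (subsetData Z I n k) (M n k l) μ :=
    hR.indepFun_subsetData k l
  have hg := measurable_bootRoot_comp n (hfit n)
  filter_upwards [condDistrib_of_indepFun hind (hS.measurable_subsetData n k)
    (hR.law n k l).aemeasurable hg]
    with ω hω hfar hmem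
  have h1 := hn (b n) (hS.size_pos n) _ hmem
  have h2 : condDistrib (fun ω' => bootRoot n (fit n (subsetData Z I n k ω')) (M n k l ω'))
      (subsetData Z I n k) μ (subsetData Z I n k ω) = bootLaw n (contrib Z I fit n k ω) := by
    rw [hω, (hR.law n k l).map_eq, bootLaw, contrib]
  have h3 : ε ≤ |levyProkhorovDist
        (condDistrib (fun ω' => bootRoot n (fit n (subsetData Z I n k ω')) (M n k l ω'))
          (subsetData Z I n k) μ (subsetData Z I n k ω))
        (gaussianReal 0 (empVar (contrib Z I fit n k ω)).toNNReal)| := hfar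
  rw [h2, levyProkhorovDist, abs_of_nonneg ENNReal.toReal_nonneg] at h3
  exact absurd h3 (not_le.2 h1)

end Replicates

/-! ### Distribution functions -/

/-- Measures that are close in the Lévy–Prokhorov distance have close distribution functions. -/
lemma cdf_le_of_levyProkhorovDist_lt {P Q : Measure ℝ} [IsProbabilityMeasure P]
    [IsProbabilityMeasure Q] {c : ℝ} (h : levyProkhorovDist P Q < c) (t : ℝ) :
    cdf P t ≤ cdf Q (t + c) + c := by
  have hc : 0 < c := lt_of_le_of_lt ENNReal.toReal_nonneg h
  have h' : levyProkhorovEDist P Q < ENNReal.ofReal c :=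
    (ENNReal.lt_ofReal_iff_toReal_lt (levyProkhorovEDist_ne_top P Q)).2 h
  have h1 := left_measure_le_of_levyProkhorovEDist_lt h' (B := Set.Iic t) measurableSet_Iic
  have h2 : Metric.thickening (ENNReal.ofReal c).toReal (Set.Iic t) ⊆ Set.Iic (t + c) := by
    intro x hx
    rw [ENNReal.toReal_ofReal hc.le, Metric.mem_thickening_iff] at hx
    obtain ⟨z, hz, hxz⟩ := hx
    rw [Real.dist_eq] at hxz
    have := (abs_lt.1 hxz).2
    simp only [Set.mem_Iic] at hz ⊢
    linarith
  rw [cdf_eq_real, cdf_eq_real, measureReal_def, measureReal_def]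
  have h3 := h1.trans (add_le_add_left (measure_mono h2) _)
  have h4 := ENNReal.toReal_mono (by finiteness) h3
  rwa [ENNReal.toReal_add (by finiteness) (by finiteness), ENNReal.toReal_ofReal hc.le] at h4

lemma strictMono_cdf_gaussianReal {v : ℝ≥0} (hv : v ≠ 0) :
    StrictMono (cdf (gaussianReal 0 v)) := by
  intro x y hxy
  rw [cdf_eq_real, cdf_eq_real, ← Set.Iic_union_Ioc_eq_Iic hxy.le,
    measureReal_union (Set.Iic_disjoint_Ioc le_rfl) measurableSet_Ioc, lt_add_iff_pos_right]
  refine ENNReal.toReal_pos (fun h0 => ?_) (by finiteness)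
  have := gaussianReal_absolutelyContinuous' 0 hv h0
  rw [Real.volume_Ioc, ENNReal.ofReal_eq_zero] at this
  linarith

lemma continuous_cdf_gaussianReal {v : ℝ≥0} (hv : v ≠ 0) :
    Continuous (cdf (gaussianReal 0 v)) := by
  have := nullSingletonClass_gaussianReal (μ := 0) hv
  refine continuous_iff_continuousAt.2 fun x => ?_
  rw [(monotone_cdf _).continuousAt_iff_leftLim_eq_rightLim, StieltjesFunction.rightLim_eq]
  have h := StieltjesFunction.measure_singleton (cdf (gaussianReal 0 v)) x
  rw [measure_cdf, measure_singleton, eq_comm, ENNReal.ofReal_eq_zero] at h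
  exact le_antisymm ((monotone_cdf _).leftLim_le le_rfl) (by linarith)

lemma exists_cdf_gaussianReal_eq {v : ℝ≥0} (hv : v ≠ 0) {p : ℝ} (hp : p ∈ Set.Ioo (0 : ℝ) 1) :
    ∃ q, cdf (gaussianReal 0 v) q = p :=
  mem_range_of_exists_le_of_exists_ge (continuous_cdf_gaussianReal hv)
    (((tendsto_cdf_atBot _).eventually_le_const hp.1).exists)
    (((tendsto_cdf_atTop _).eventually_const_le hp.2).exists)

/-! ### Concentration of the bootstrap quantiles within a subset -/

section Concentration

variable {Ω β : Type*} [MeasurableSpace Ω] [MeasurableSpace β] {μ : Measure Ω}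
  [IsProbabilityMeasure μ]

/-- Chebyshev's inequality for the number of occurrences of an event in independent trials. -/
lemma measure_abs_sum_indicator_sub_le {r : ℕ} (hr : 0 < r) {W : Fin r → Ω → β}
    (hW : iIndepFun W μ) (hWm : ∀ l, AEMeasurable (W l) μ) {B : Set β} (hB : MeasurableSet B)
    {q : ℝ} (hq : ∀ l, (μ.map (W l)).real B = q) {δ : ℝ} (hδ : 0 < δ) :
    μ {ω | δ * r ≤ |∑ l, B.indicator (1 : β → ℝ) (W l ω) - q * r|}
      ≤ ENNReal.ofReal (1 / (r * δ ^ 2)) := by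
  have hr' : (0 : ℝ) < r := by exact_mod_cast hr
  set X : Fin r → Ω → ℝ := fun l ω => B.indicator (1 : β → ℝ) (W l ω) with hX
  have hind : Measurable (B.indicator (1 : β → ℝ)) := measurable_one.indicator hB
  have hXm (l) : AEMeasurable (X l) μ := hind.comp_aemeasurable (hWm l)
  have hX0 (l ω) : 0 ≤ X l ω := Set.indicator_nonneg (by simp) _
  have hX1 (l ω) : X l ω ≤ 1 := Set.indicator_le_self' (by simp) _ |>.trans (by simp)
  have hXL (l) : MemLp (X l) 2 μ :=
    MemLp.of_bound (hXm l).aestronglyMeasurable 1 (ae_of_all _ fun ω => by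
      rw [Real.norm_eq_abs, abs_of_nonneg (hX0 l ω)]; exact hX1 l ω)
  have hXi : iIndepFun X μ := hW.comp (fun _ => B.indicator (1 : β → ℝ)) fun _ => hind
  have hmean (l) : ∫ ω, X l ω ∂μ = q := by
    rw [← hq l, ← integral_indicator_one hB, integral_map (hWm l) hind.aestronglyMeasurable]
  have hvar (l) : Var[X l; μ] ≤ 1 := by
    refine (variance_le_expectation_sq (hXm l).aestronglyMeasurable).trans ?_
    calc ∫ ω, (X l ^ 2) ω ∂μ ≤ ∫ _ω, (1 : ℝ) ∂μ :=
          integral_mono (hXL l).integrable_sq (integrable_const _) fun ω =>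
            pow_le_one₀ (hX0 l ω) (hX1 l ω)
      _ = 1 := by simp
  have hsum : Var[∑ l, X l; μ] ≤ r := by
    rw [IndepFun.variance_sum (fun l _ => hXL l) fun l _ l' _ hll' => hXi.indepFun hll']
    calc ∑ l, Var[X l; μ] ≤ ∑ _l : Fin r, (1 : ℝ) := Finset.sum_le_sum fun l _ => hvar l
      _ = r := by simp
  have hE : ∫ ω, (∑ l, X l) ω ∂μ = q * r := by
    simp only [Finset.sum_apply]
    rw [integral_finsetSum _ fun l _ => (hXL l).integrable one_le_two]
    simp [hmean, mul_comm]
  have h := meas_ge_le_variance_div_sq (memLp_finsetSum' Finset.univ fun l _ => hXL l)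
    (by positivity : 0 < δ * r)
  rw [hE] at h
  simp only [Finset.sum_apply] at h
  refine h.trans (ENNReal.ofReal_le_ofReal ?_)
  calc Var[∑ l, X l; μ] / (δ * r) ^ 2 ≤ r / (δ * r) ^ 2 := by gcongr
    _ = 1 / (r * δ ^ 2) := by field_simp

end Concentration

section Quantiles

variable {Ω 𝒵 : Type*} [MeasurableSpace Ω] [MeasurableSpace 𝒵] {μ : Measure Ω}
  [IsProbabilityMeasure μ] {Z : ℕ → Ω → 𝒵} {s b : ℕ → ℕ}
  {I : (n : ℕ) → Ω → Fin (s n) → Fin (b n) → Fin n}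
  {fit : (n : ℕ) → (Fin (b n) → 𝒵) → Fin (b n) → ℝ}
  {M : (n : ℕ) → Fin (s n) → ℕ → Ω → Fin (b n) → ℕ}
  {ψ : 𝒵 → ℝ} {θ₀ : ℝ}

/-- The number of the replicates of the list `x`, with counts `m`, whose root is at most `t`. -/
noncomputable def rootCount {b r : ℕ} (n : ℕ) (t : ℝ) (x : Fin b → ℝ) (m : Fin r → Fin b → ℕ) :
    ℝ :=
  ((Finset.univ.filter fun l => bootRoot n x (m l) ≤ t).card : ℝ)

lemma rootCount_eq_sum {b r : ℕ} (n : ℕ) (t : ℝ) (x : Fin b → ℝ) (m : Fin r → Fin b → ℕ) :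
    rootCount n t x m
      = ∑ l, {m' : Fin b → ℕ | bootRoot n x m' ≤ t}.indicator (1 : (Fin b → ℕ) → ℝ) (m l) := by
  rw [rootCount, Finset.card_filter]
  push_cast
  rfl

lemma measurable_rootCount {α : Type*} [MeasurableSpace α] {b r : ℕ} (n : ℕ) (t : ℝ)
    {f : α → Fin b → ℝ} (hf : Measurable f) :
    Measurable fun p : α × (Fin r → Fin b → ℕ) => rootCount n t (f p.1) p.2 := by
  simp only [rootCount, Finset.card_filter]
  push_cast
  refine Finset.measurable_fun_sum _ fun l _ => Measurable.ite ?_ measurable_const measurable_const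
  have h : Measurable fun p : α × (Fin r → Fin b → ℕ) => (p.1, p.2 l) :=
    measurable_fst.prodMk ((measurable_pi_apply l).comp measurable_snd)
  have h2 := Measurable.comp (g := fun q : α × (Fin b → ℕ) => bootRoot n (f q.1) q.2)
    (measurable_bootRoot_comp n hf) h
  exact measurableSet_le h2 measurable_const

omit [IsProbabilityMeasure μ] in
lemma IsResampling.aemeasurable_pi (hR : IsResampling μ Z I M) {n : ℕ} (k : Fin (s n)) (r : ℕ) :
    AEMeasurable (fun ω (l : Fin r) => M n k l ω) μ :=
  aemeasurable_pi_lambda _ fun l => (hR.law n k l).aemeasurable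

omit [IsProbabilityMeasure μ] in
lemma IsResampling.indepFun_subsetData_pi (hR : IsResampling μ Z I M) {n : ℕ} (k : Fin (s n))
    (r : ℕ) : IndepFun (subsetData Z I n k) (fun ω (l : Fin r) => M n k l ω) μ := by
  have h : Measurable fun (m : Fin (s n) × ℕ → Fin (b n) → ℕ) (l : Fin r) => m (k, (l : ℕ)) :=
    measurable_pi_lambda _ fun l => measurable_pi_apply _
  exact (hR.indep_data n).comp (measurable_selectBlock k) h

/-- Chebyshev's inequality for the counts of replicates, conditionally on the data of the subset:
on a set `G` of lists of contributions, the count of roots below `t` avoids a set `C` whose points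
are at distance at least `δ r` from the conditional expectation. -/
lemma measure_rootCount_mem_le (hS : IsSubsampling μ Z I) (hfit : ∀ n, Measurable (fit n))
    (hR : IsResampling μ Z I M) {n : ℕ} (k : Fin (s n)) {r : ℕ} (hr : 0 < r)
    {G : Set (Fin (b n) → ℝ)} (hG : MeasurableSet G) {C : Set ℝ} (hC : MeasurableSet C) {t δ : ℝ}
    (hδ : 0 < δ)
    (h : ∀ x ∈ G, ∀ c ∈ C, δ * r ≤ |c - cdf (bootLaw n x) t * r|) :
    μ {ω | contrib Z I fit n k ω ∈ G ∧
        rootCount n t (contrib Z I fit n k ω) (fun l : Fin r => M n k l ω) ∈ C}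
      ≤ ENNReal.ofReal (1 / (r * δ ^ 2)) := by
  have hSm : MeasurableSet {p : (Fin (b n) → 𝒵) × (Fin r → Fin (b n) → ℕ) |
      fit n p.1 ∈ G ∧ rootCount n t (fit n p.1) p.2 ∈ C} :=
    (((hfit n).comp measurable_fst) hG).inter (measurable_rootCount n t (hfit n) hC)
  refine measure_le_of_indepFun (hR.indepFun_subsetData_pi k r) (hS.measurable_subsetData n k)
    (hR.aemeasurable_pi k r) hSm fun z => ?_
  by_cases hz : fit n z ∈ G
  · have hprob := isProbabilityMeasure_bootLaw (hS.size_pos n) n (fit n z)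
    have hB : MeasurableSet {m : Fin (b n) → ℕ | bootRoot n (fit n z) m ≤ t} := .of_discrete
    have hind : iIndepFun (fun (l : Fin r) ω => M n k l ω) μ := by
      have hinj : Function.Injective fun l : Fin r => (k, (l : ℕ)) := fun l l' hll' =>
        Fin.ext (Prod.ext_iff.1 hll').2
      exact (hR.indep n).precomp hinj
    have hcheb := measure_abs_sum_indicator_sub_le hr hind
      (fun l => (hR.law n k l).aemeasurable) hB (q := cdf (bootLaw n (fit n z)) t) (fun l => by
        rw [(hR.law n k l).map_eq, cdf_eq_real, bootLaw,
          map_measureReal_apply Measurable.of_discrete measurableSet_Iic]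
        rfl) hδ
    refine (measure_mono fun ω hω => ?_).trans hcheb
    have := h _ hz _ hω.2
    rw [rootCount_eq_sum] at this
    exact this
  · have : {ω | (z, fun l : Fin r => M n k l ω) ∈ {p : (Fin (b n) → 𝒵) × (Fin r → Fin (b n) → ℕ) |
      fit n p.1 ∈ G ∧ rootCount n t (fit n p.1) p.2 ∈ C}} = ∅ := by
      ext ω
      simp [hz]
    rw [this]
    simp

/-- The centred and scaled bootstrap quantile of a subset. -/
noncomputable def rootQuantile (Z : ℕ → Ω → 𝒵)
    (I : (n : ℕ) → Ω → Fin (s n) → Fin (b n) → Fin n)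
    (fit : (n : ℕ) → (Fin (b n) → 𝒵) → Fin (b n) → ℝ)
    (M : (n : ℕ) → Fin (s n) → ℕ → Ω → Fin (b n) → ℕ) (r : ℕ → ℕ) (p : ℝ)
    (n : ℕ) (k : Fin (s n)) (ω : Ω) : ℝ :=
  empQuantile p fun l : Fin (r n) => bootRoot n (contrib Z I fit n k ω) (M n k l ω)

omit [MeasurableSpace Ω] [MeasurableSpace 𝒵] in
lemma rootQuantile_le_iff {r : ℕ → ℕ} {p : ℝ} (hp : p ∈ Set.Ioo (0 : ℝ) 1) {n : ℕ}
    (hr : 0 < r n) (k : Fin (s n)) (ω : Ω) (t : ℝ) :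
    rootQuantile Z I fit M r p n k ω ≤ t ↔
      p * r n ≤ rootCount n t (contrib Z I fit n k ω) (fun l : Fin (r n) => M n k l ω) :=
  empQuantile_le_iff hp hr _ t

/-- Within a subset the bootstrap quantile converges to the Gaussian one in probability, uniformly
over the subsets. -/
lemma unifNull_rootQuantile (hS : IsSubsampling μ Z I) (hψ : IsInfluence μ Z ψ)
    (hfit : ∀ n, Measurable (fit n)) (hR : IsResampling μ Z I M)
    (h_rem_sq : SubsetLittleOp μ s fun (n : ℕ) k ω =>
      (∑ a, remainder Z I fit θ₀ ψ n k ω a ^ 2) / b n)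
    {r : ℕ → ℕ} (hr : Tendsto r atTop atTop) (hV : 0 < Var[ψ; μ.map (Z 0)])
    {p : ℝ} (hp : p ∈ Set.Ioo (0 : ℝ) 1) {q : ℝ}
    (hq : cdf (gaussianReal 0 Var[ψ; μ.map (Z 0)].toNNReal) q = p) {ε : ℝ} (hε : 0 < ε) :
    UnifNull μ fun n k => {ω | ε ≤ |rootQuantile Z I fit M r p n k ω - q|} := by
  set V := Var[ψ; μ.map (Z 0)] with hVdef
  set Φ := cdf (gaussianReal 0 V.toNNReal) with hΦ
  have hVn : V.toNNReal ≠ 0 := (Real.toNNReal_pos.2 hV).ne'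
  have hmono := strictMono_cdf_gaussianReal hVn
  have hup : p < Φ (q + ε / 4) := by rw [← hq]; exact hmono (by linarith)
  have hlo : Φ (q - ε / 4) < p := by rw [← hq]; exact hmono (by linarith)
  obtain ⟨δ, hδ, hδu, hδl⟩ : ∃ δ > 0, p + 2 * δ ≤ Φ (q + ε / 4) ∧ Φ (q - ε / 4) + 2 * δ ≤ p := by
    refine ⟨min ((Φ (q + ε / 4) - p) / 2) ((p - Φ (q - ε / 4)) / 2),
      lt_min (by linarith) (by linarith), ?_, ?_⟩
    · linarith [min_le_left ((Φ (q + ε / 4) - p) / 2) ((p - Φ (q - ε / 4)) / 2)]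
    · linarith [min_le_right ((Φ (q + ε / 4) - p) / 2) ((p - Φ (q - ε / 4)) / 2)]
  have hc : 0 < min (ε / 4) δ := by positivity
  obtain ⟨δ', hδ', hclt⟩ := exists_forall_levyProkhorovDist_bootLaw_lt hV.le hc
  have hnull := unifNull_contrib_notMem_cltSet hS hψ h_rem_sq hδ'
  have hcheb0 : Tendsto (fun n => ENNReal.ofReal (1 / ((r n : ℝ) * δ ^ 2))) atTop (𝓝 0) := by
    rw [← ENNReal.ofReal_zero]
    refine (ENNReal.continuous_ofReal.tendsto 0).comp ?_
    have : Tendsto (fun n => (r n : ℝ) * δ ^ 2) atTop atTop :=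
      (tendsto_natCast_atTop_atTop.comp hr).atTop_mul_const (by positivity)
    simp only [one_div]
    exact this.inv_tendsto_atTop
  have hbound : ∀ᶠ n in atTop, ∀ x ∈ cltSet (b n) V δ' n,
      p + δ ≤ cdf (bootLaw n x) (q + ε / 2) ∧ cdf (bootLaw n x) (q - ε) ≤ p - δ := by
    filter_upwards [hclt] with n hn x hx
    have hprob := isProbabilityMeasure_bootLaw (hS.size_pos n) n x
    have h1 := hn (b n) (hS.size_pos n) x hx
    have h2 := cdf_le_of_levyProkhorovDist_lt h1 (q - ε)
    rw [levyProkhorovDist_comm] at h1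
    have h3 := cdf_le_of_levyProkhorovDist_lt h1 (q + ε / 4)
    have hc1 := min_le_left (ε / 4) δ
    have hc2 := min_le_right (ε / 4) δ
    have h4 := monotone_cdf (bootLaw n x)
      (show q + ε / 4 + min (ε / 4) δ ≤ q + ε / 2 by linarith)
    have h5 := monotone_cdf (gaussianReal 0 V.toNNReal)
      (show q - ε + min (ε / 4) δ ≤ q - ε / 4 by linarith)
    constructor <;> linarith
  have u₁ : UnifNull μ fun n k => {ω | contrib Z I fit n k ω ∈ cltSet (b n) V δ' n ∧
      rootCount n (q + ε / 2) (contrib Z I fit n k ω) (fun l : Fin (r n) => M n k l ω)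
        ∈ Set.Iio (p * r n)} := by
    rw [unifNull_iff]
    intro η hη
    filter_upwards [hbound, ENNReal.tendsto_nhds_zero.1 hcheb0 η hη, hr.eventually_gt_atTop 0]
      with n h1 h2 hrn k
    refine (measure_rootCount_mem_le hS hfit hR k hrn (measurableSet_cltSet V δ' n)
      measurableSet_Iio hδ fun x hx c hcx => ?_).trans h2
    have h3 := (h1 x hx).1
    have hrn' : (0 : ℝ) < r n := by exact_mod_cast hrn
    have hcx' : c < p * r n := hcx
    rw [abs_sub_comm]
    refine le_trans ?_ (le_abs_self _)
    nlinarith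
  have u₂ : UnifNull μ fun n k => {ω | contrib Z I fit n k ω ∈ cltSet (b n) V δ' n ∧
      rootCount n (q - ε) (contrib Z I fit n k ω) (fun l : Fin (r n) => M n k l ω)
        ∈ Set.Ici (p * r n)} := by
    rw [unifNull_iff]
    intro η hη
    filter_upwards [hbound, ENNReal.tendsto_nhds_zero.1 hcheb0 η hη, hr.eventually_gt_atTop 0]
      with n h1 h2 hrn k
    refine (measure_rootCount_mem_le hS hfit hR k hrn (measurableSet_cltSet V δ' n)
      measurableSet_Ici hδ fun x hx c hcx => ?_).trans h2
    have h3 := (h1 x hx).2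
    have hrn' : (0 : ℝ) < r n := by exact_mod_cast hrn
    have hcx' : p * r n ≤ c := hcx
    refine le_trans ?_ (le_abs_self _)
    nlinarith
  refine ((hnull.union u₁).union u₂).mono ?_
  filter_upwards [hr.eventually_gt_atTop 0] with n hrn k ω hω
  by_cases hmem : contrib Z I fit n k ω ∈ cltSet (b n) V δ' n
  · have hω' : ε ≤ |rootQuantile Z I fit M r p n k ω - q| := hω
    rcases le_abs'.1 hω' with h1 | h1
    · right
      exact ⟨hmem, (rootQuantile_le_iff hp hrn k ω _).1 (by linarith)⟩
    · left; right
      refine ⟨hmem, Set.mem_Iio.2 (not_le.1 fun h2 => ?_)⟩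
      have := (rootQuantile_le_iff (Z := Z) (I := I) (fit := fit) (M := M) hp hrn k ω _).2 h2
      linarith
  · left; left
    exact hmem

end Quantiles

/-! ### Averages of the bootstrap quantiles over the subsets -/

lemma measurable_empQuantile {p : ℝ} (hp : p ∈ Set.Ioo (0 : ℝ) 1) (r : ℕ) :
    Measurable (empQuantile p (r := r)) := by
  rcases Nat.eq_zero_or_pos r with rfl | hr
  · exact Subsingleton.measurable
  refine measurable_of_Iic fun t => ?_
  have : empQuantile p (r := r) ⁻¹' Set.Iic t
      = {y | p * r ≤ ∑ l, if y l ≤ t then (1 : ℝ) else 0} := by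
    ext y
    rw [Set.mem_preimage, Set.mem_Iic, empQuantile_le_iff hp hr, Finset.card_filter]
    push_cast
    rfl
  rw [this]
  refine measurableSet_le measurable_const (Finset.measurable_fun_sum _ fun l _ =>
    Measurable.ite ?_ measurable_const measurable_const)
  exact measurableSet_le (by fun_prop) measurable_const

lemma aemeasurable_bootRoot {Ω : Type*} [MeasurableSpace Ω] {μ : Measure Ω} {m : ℕ} (n : ℕ)
    {f : Ω → Fin m → ℝ} {g : Ω → Fin m → ℕ} (hf : AEMeasurable f μ) (hg : AEMeasurable g μ) :
    AEMeasurable (fun ω => bootRoot n (f ω) (g ω)) μ := by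
  have h : AEMeasurable (fun ω => (f ω, g ω)) μ := hf.prodMk hg
  have h2 := (measurable_bootRoot (b := m) n).comp_aemeasurable h
  exact h2

/-- Averages of functions with the same weighted integrals have the same weighted integral. -/
lemma lintegral_mul_ofReal_average_congr {Ω : Type*} [MeasurableSpace Ω] {μ : Measure Ω} {m : ℕ}
    (hm : 0 < m) {w : Ω → ℝ≥0∞} (hw : AEMeasurable w μ) {X Y : Fin m → Ω → ℝ}
    (hX : ∀ k, AEMeasurable (X k) μ) (hY : ∀ k, AEMeasurable (Y k) μ) (hX0 : ∀ k ω, 0 ≤ X k ω)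
    (hY0 : ∀ k ω, 0 ≤ Y k ω)
    (h : ∀ k, ∫⁻ ω, w ω * ENNReal.ofReal (X k ω) ∂μ = ∫⁻ ω, w ω * ENNReal.ofReal (Y k ω) ∂μ) :
    ∫⁻ ω, w ω * ENNReal.ofReal ((∑ k, X k ω) / m) ∂μ
      = ∫⁻ ω, w ω * ENNReal.ofReal ((∑ k, Y k ω) / m) ∂μ := by
  have key : ∀ T : Fin m → Ω → ℝ, (∀ k, AEMeasurable (T k) μ) → (∀ k ω, 0 ≤ T k ω) →
      ∫⁻ ω, w ω * ENNReal.ofReal ((∑ k, T k ω) / m) ∂μ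
        = (m : ℝ≥0∞)⁻¹ * ∑ k, ∫⁻ ω, w ω * ENNReal.ofReal (T k ω) ∂μ := by
    intro T hT hT0
    have hwT (k) : AEMeasurable (fun ω => w ω * ENNReal.ofReal (T k ω)) μ :=
      hw.mul (hT k).ennreal_ofReal
    rw [← lintegral_finsetSum' _ fun k _ => hwT k,
      ← lintegral_const_mul'' _ (Finset.aemeasurable_fun_sum _ fun k _ => hwT k)]
    refine lintegral_congr fun ω => ?_
    rw [ofReal_average hm (hT0 · ω), ← Finset.mul_sum]
    ring
  rw [key X hX hX0, key Y hY hY0]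
  simp only [h]

section Averages

variable {Ω 𝒵 : Type*} [MeasurableSpace Ω] [MeasurableSpace 𝒵] {μ : Measure Ω}
  [IsProbabilityMeasure μ] {Z : ℕ → Ω → 𝒵} {s b : ℕ → ℕ}
  {I : (n : ℕ) → Ω → Fin (s n) → Fin (b n) → Fin n}
  {fit : (n : ℕ) → (Fin (b n) → 𝒵) → Fin (b n) → ℝ}
  {M : (n : ℕ) → Fin (s n) → ℕ → Ω → Fin (b n) → ℕ}
  {ψ : 𝒵 → ℝ} {θ₀ : ℝ}

omit [IsProbabilityMeasure μ] in
lemma aemeasurable_root (hS : IsSubsampling μ Z I) (hfit : ∀ n, Measurable (fit n))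
    (hR : IsResampling μ Z I M) (n : ℕ) (k : Fin (s n)) (l : ℕ) :
    AEMeasurable (fun ω => bootRoot n (contrib Z I fit n k ω) (M n k l ω)) μ :=
  aemeasurable_bootRoot n (measurable_contrib hS hfit n k).aemeasurable (hR.law n k l).aemeasurable

omit [IsProbabilityMeasure μ] in
lemma aemeasurable_rootQuantile (hS : IsSubsampling μ Z I) (hfit : ∀ n, Measurable (fit n))
    (hR : IsResampling μ Z I M) (r : ℕ → ℕ) {p : ℝ} (hp : p ∈ Set.Ioo (0 : ℝ) 1) (n : ℕ)
    (k : Fin (s n)) : AEMeasurable (rootQuantile Z I fit M r p n k) μ :=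
  Measurable.comp_aemeasurable (g := empQuantile p (r := r n)) (measurable_empQuantile hp (r n))
    (aemeasurable_pi_lambda _ fun l => aemeasurable_root hS hfit hR n k l)

/-- The conditional second moment of a root given the data is the empirical variance of the
contributions. -/
lemma lintegral_mul_root_sq (hS : IsSubsampling μ Z I) (hfit : ∀ n, Measurable (fit n))
    (hR : IsResampling μ Z I M) {n : ℕ} (hn : 0 < n) (k : Fin (s n)) (l : ℕ)
    {w : (ℕ → 𝒵) × (Fin (s n) → Fin (b n) → Fin n) → ℝ≥0∞} (hw : Measurable w) :
    ∫⁻ ω, w (dataOf Z I n ω)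
        * ENNReal.ofReal (bootRoot n (contrib Z I fit n k ω) (M n k l ω) ^ 2) ∂μ
      = ∫⁻ ω, w (dataOf Z I n ω) * ENNReal.ofReal (empVar (contrib Z I fit n k ω)) ∂μ := by
  have hm : Measurable fun d : (ℕ → 𝒵) × (Fin (s n) → Fin (b n) → Fin n) =>
      fit n (selectBlock k d) := (hfit n).comp (measurable_selectBlock k)
  have hroot := measurable_bootRoot_comp n hm
  have hF := (hw.comp measurable_fst).mul (hroot.pow_const 2).ennreal_ofReal
  have h := lintegral_prod_of_indepFun (hR.indepFun_dataOf k l)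
    (measurable_dataOf hS.measurable_sample hS.measurable_partition n)
    (hR.law n k l).aemeasurable hF
  refine h.trans (lintegral_congr fun ω => ?_)
  rw [(hR.law n k l).map_eq]
  have h2 := lintegral_sq_bootLaw (hS.size_pos n) hn (contrib Z I fit n k ω)
  rw [bootLaw, lintegral_map (by fun_prop) Measurable.of_discrete] at h2
  rw [← h2, ← lintegral_const_mul _ Measurable.of_discrete]
  rfl

/-- The mean squares of the bootstrap quantiles are stochastically bounded. -/
lemma exists_eventually_measure_average_sq_le (hS : IsSubsampling μ Z I)
    (hfit : ∀ n, Measurable (fit n)) (hR : IsResampling μ Z I M) (hs : ∀ᶠ n in atTop, 0 < s n)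
    {r : ℕ → ℕ} (hr : Tendsto r atTop atTop) {V : ℝ} (hV : 0 ≤ V)
    (h_var : TendstoInMeasure μ
      (fun n ω => (∑ k : Fin (s n), empVar (contrib Z I fit n k ω)) / s n) atTop (fun _ => V))
    {p : ℝ} (hp : p ∈ Set.Ioo (0 : ℝ) 1) {η : ℝ} (hη : 0 < η) :
    ∃ K > 0, ∀ᶠ n in atTop,
      μ {ω | K ≤ (∑ k, rootQuantile Z I fit M r p n k ω ^ 2) / s n} ≤ ENNReal.ofReal η := by
  have hm0 : 0 < min p (1 - p) := lt_min hp.1 (by linarith [hp.2])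
  set m₀ := min p (1 - p) with hm₀
  refine ⟨2 * (V + 1) / (m₀ * η), by positivity, ?_⟩
  have h1 := unifNull_iff_real.1 ((tendstoInMeasure_const_iff.1 h_var) 1 one_pos) (η / 2)
    (half_pos hη)
  filter_upwards [h1, hs, hr.eventually_gt_atTop 0, eventually_gt_atTop 0] with n hn hsn hrn hn0
  have hsn' : (0 : ℝ) < s n := by exact_mod_cast hsn
  have hrn' : (0 : ℝ) < r n := by exact_mod_cast hrn
  set avgVar : ((ℕ → 𝒵) × (Fin (s n) → Fin (b n) → Fin n)) → ℝ := fun d =>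
    (∑ k, empVar (fit n (selectBlock k d))) / s n with havg
  have havgm : Measurable avgVar := by
    refine (Finset.measurable_fun_sum _ fun k _ => ?_).div_const _
    exact measurable_empVar.comp ((hfit n).comp (measurable_selectBlock k))
  set w : ((ℕ → 𝒵) × (Fin (s n) → Fin (b n) → Fin n)) → ℝ≥0∞ := fun d =>
    if avgVar d < V + 1 then 1 else 0 with hwdef
  have hw : Measurable w :=
    Measurable.ite (measurableSet_lt havgm measurable_const) measurable_const measurable_const
  have hw' : AEMeasurable (fun ω => w (dataOf Z I n ω)) μ := (hw.comp
    (measurable_dataOf hS.measurable_sample hS.measurable_partition n)).aemeasurable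
  have hrootm (k : Fin (s n)) (l : Fin (r n)) :
      AEMeasurable (fun ω => bootRoot n (contrib Z I fit n k ω) (M n k l ω) ^ 2) μ :=
    (aemeasurable_root hS hfit hR n k l).pow_const 2
  -- the averages over the replicates of the squared roots
  set W : Fin (s n) → Ω → ℝ := fun k ω =>
    (∑ l : Fin (r n), bootRoot n (contrib Z I fit n k ω) (M n k l ω) ^ 2) / r n with hW
  have hW0 (k ω) : 0 ≤ W k ω :=
    div_nonneg (Finset.sum_nonneg fun l _ => sq_nonneg _) hrn'.le
  have hWm (k) : AEMeasurable (W k) μ :=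
    (Finset.aemeasurable_fun_sum _ fun l _ => hrootm k l).div_const _
  have hVm (k : Fin (s n)) : AEMeasurable (fun ω => empVar (contrib Z I fit n k ω)) μ :=
    (measurable_empVar.comp (measurable_contrib hS hfit n k)).aemeasurable
  have hQ (k : Fin (s n)) (ω) : m₀ * rootQuantile Z I fit M r p n k ω ^ 2 ≤ W k ω :=
    empQuantile_sq_le hp hrn _
  have hsub : {ω | 2 * (V + 1) / (m₀ * η) ≤ (∑ k, rootQuantile Z I fit M r p n k ω ^ 2) / s n}
      ⊆ {ω | 1 ≤ |(∑ k : Fin (s n), empVar (contrib Z I fit n k ω)) / s n - V|}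
        ∪ {ω | ENNReal.ofReal (2 * (V + 1) / η)
          ≤ w (dataOf Z I n ω) * ENNReal.ofReal ((∑ k, W k ω) / s n)} := by
    intro ω hω
    by_cases hg : avgVar (dataOf Z I n ω) < V + 1
    · right
      simp only [Set.mem_ofPred_eq, hwdef, if_pos hg, one_mul]
      refine ENNReal.ofReal_le_ofReal ?_
      have hω' : 2 * (V + 1) / (m₀ * η) ≤ (∑ k, rootQuantile Z I fit M r p n k ω ^ 2) / s n := hω
      calc 2 * (V + 1) / η = m₀ * (2 * (V + 1) / (m₀ * η)) := by field_simp
        _ ≤ m₀ * ((∑ k, rootQuantile Z I fit M r p n k ω ^ 2) / s n) := by gcongr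
        _ = (∑ k, m₀ * rootQuantile Z I fit M r p n k ω ^ 2) / s n := by
          rw [← Finset.mul_sum, mul_div_assoc]
        _ ≤ (∑ k, W k ω) / s n :=
          div_le_div_of_nonneg_right (Finset.sum_le_sum fun k _ => hQ k ω) hsn'.le
    · left
      have hg' : V + 1 ≤ (∑ k : Fin (s n), empVar (contrib Z I fit n k ω)) / s n := not_lt.1 hg
      exact le_trans (le_sub_iff_add_le'.2 hg') (le_abs_self _)
  have hinner (k : Fin (s n)) : ∫⁻ ω, w (dataOf Z I n ω) * ENNReal.ofReal (W k ω) ∂μ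
      = ∫⁻ ω, w (dataOf Z I n ω) * ENNReal.ofReal (empVar (contrib Z I fit n k ω)) ∂μ := by
    have h := lintegral_mul_ofReal_average_congr hrn hw' (hrootm k)
      (Y := fun _ ω => empVar (contrib Z I fit n k ω)) (fun _ => hVm k)
      (fun l ω => sq_nonneg _) (fun _ ω => empVar_nonneg _)
      (fun l => lintegral_mul_root_sq hS hfit hR hn0 k l hw)
    refine h.trans (lintegral_congr fun ω => ?_)
    rw [Finset.sum_const, Finset.card_univ, Fintype.card_fin, nsmul_eq_mul,
      mul_div_cancel_left₀ _ hrn'.ne']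
  have hint : ∫⁻ ω, w (dataOf Z I n ω) * ENNReal.ofReal ((∑ k, W k ω) / s n) ∂μ
      ≤ ENNReal.ofReal (V + 1) := by
    rw [lintegral_mul_ofReal_average_congr hsn hw' hWm hVm hW0 (fun k ω => empVar_nonneg _) hinner]
    calc ∫⁻ ω, w (dataOf Z I n ω)
          * ENNReal.ofReal ((∑ k, empVar (contrib Z I fit n k ω)) / s n) ∂μ
        ≤ ∫⁻ _ω, ENNReal.ofReal (V + 1) ∂μ := by
          refine lintegral_mono fun ω => ?_
          by_cases hg : avgVar (dataOf Z I n ω) < V + 1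
          · simp only [hwdef, if_pos hg, one_mul]
            exact ENNReal.ofReal_le_ofReal (le_of_lt hg)
          · simp only [hwdef, if_neg hg, zero_mul, zero_le]
      _ = ENNReal.ofReal (V + 1) := by simp
  have hWm' : AEMeasurable
      (fun ω => w (dataOf Z I n ω) * ENNReal.ofReal ((∑ k, W k ω) / s n)) μ :=
    hw'.mul ((Finset.aemeasurable_fun_sum _ fun k _ => hWm k).div_const _).ennreal_ofReal
  have hpos : 0 < 2 * (V + 1) / η := by positivity
  have hmark : μ {ω | ENNReal.ofReal (2 * (V + 1) / η)
      ≤ w (dataOf Z I n ω) * ENNReal.ofReal ((∑ k, W k ω) / s n)} ≤ ENNReal.ofReal (η / 2) := by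
    refine (meas_ge_le_lintegral_div hWm' (ENNReal.ofReal_pos.2 hpos).ne'
      ENNReal.ofReal_ne_top).trans ((ENNReal.div_le_div_right hint _).trans (le_of_eq ?_))
    rw [← ENNReal.ofReal_div_of_pos hpos]
    congr 1
    field_simp
  calc μ {ω | 2 * (V + 1) / (m₀ * η) ≤ (∑ k, rootQuantile Z I fit M r p n k ω ^ 2) / s n}
      ≤ ENNReal.ofReal (η / 2) + ENNReal.ofReal (η / 2) :=
        (measure_mono hsub).trans ((measure_union_le _ _).trans (add_le_add (hn ()) hmark))
    _ = ENNReal.ofReal η := by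
        rw [← ENNReal.ofReal_add (by positivity) (by positivity), add_halves]

/-- The average over the subsets of the centred and scaled bootstrap quantiles converges to the
Gaussian quantile. The squares are stochastically bounded on average, so the few subsets with an
atypical quantile do not contribute. -/
lemma tendstoInMeasure_average_rootQuantile (hS : IsSubsampling μ Z I) (hψ : IsInfluence μ Z ψ)
    (hfit : ∀ n, Measurable (fit n)) (hR : IsResampling μ Z I M) (hs : ∀ᶠ n in atTop, 0 < s n)
    (h_rem_sq : SubsetLittleOp μ s fun (n : ℕ) k ω =>
      (∑ a, remainder Z I fit θ₀ ψ n k ω a ^ 2) / b n)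
    (h_avg : TendstoInMeasure μ (fun n ω => (∑ k : Fin (s n),
        (∑ a, remainder Z I fit θ₀ ψ n k ω a ^ 2) / b n) / s n) atTop (fun _ => (0 : ℝ)))
    {r : ℕ → ℕ} (hr : Tendsto r atTop atTop) (hV : 0 < Var[ψ; μ.map (Z 0)])
    {p : ℝ} (hp : p ∈ Set.Ioo (0 : ℝ) 1) {q : ℝ}
    (hq : cdf (gaussianReal 0 Var[ψ; μ.map (Z 0)].toNNReal) q = p) :
    TendstoInMeasure μ (fun n ω => (∑ k, rootQuantile Z I fit M r p n k ω) / s n) atTop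
      (fun _ => q) := by
  rw [tendstoInMeasure_const_iff]
  intro ε hε
  rw [unifNull_iff_real]
  intro η hη
  obtain ⟨K, hK, hKn⟩ := exists_eventually_measure_average_sq_le hS hfit hR hs hr hV.le
    (tendstoInMeasure_average_empVar hS hψ hs h_avg) hp (half_pos hη)
  obtain ⟨ζ, hζ, hζK⟩ : ∃ ζ > 0, ζ * (2 * K + 2 * q ^ 2) = ε / 4 :=
    ⟨ε / 4 / (2 * K + 2 * q ^ 2), by positivity, by field_simp⟩
  have hprop := (unifNull_rootQuantile hS hψ hfit hR h_rem_sq hr hV hp hq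
    (half_pos hε)).tendstoInMeasure_proportion fun n k =>
      nullMeasurableSet_le aemeasurable_const
        ((aemeasurable_rootQuantile hS hfit hR r hp n k).sub_const q).abs
  have hprop' := unifNull_iff_real.1 ((tendstoInMeasure_const_iff.1 hprop) (ε * ζ) (by positivity))
    (η / 2) (half_pos hη)
  filter_upwards [hKn, hprop', hs] with n h1 h2 hsn _
  have hsn' : (0 : ℝ) < s n := by exact_mod_cast hsn
  set A : Fin (s n) → Set Ω := fun k => {ω | ε / 2 ≤ |rootQuantile Z I fit M r p n k ω - q|}
    with hA
  calc μ {ω | ε ≤ |(∑ k, rootQuantile Z I fit M r p n k ω) / s n - q|}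
      ≤ μ ({ω | K ≤ (∑ k, rootQuantile Z I fit M r p n k ω ^ 2) / s n}
          ∪ {ω | ε * ζ ≤ |(∑ k, (A k).indicator (1 : Ω → ℝ) ω) / s n - 0|}) := by
        refine measure_mono fun ω hω => ?_
        by_contra hcon
        simp only [Set.mem_union, Set.mem_ofPred_eq, not_or, not_le, sub_zero] at hcon
        obtain ⟨g1, g2⟩ := hcon
        have g2' := (le_abs_self _).trans_lt g2
        refine (not_le.2 ?_) (show ε ≤ _ from hω)
        have e0 : (∑ k, rootQuantile Z I fit M r p n k ω) / s n - q
            = (∑ k, (rootQuantile Z I fit M r p n k ω - q)) / s n := by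
          rw [Finset.sum_sub_distrib, Finset.sum_const, Finset.card_univ, Fintype.card_fin,
            nsmul_eq_mul]
          field_simp
        have hk : ∀ k, |rootQuantile Z I fit M r p n k ω - q|
            ≤ ε / 2 + ζ * (2 * rootQuantile Z I fit M r p n k ω ^ 2 + 2 * q ^ 2)
              + (4 * ζ)⁻¹ * (A k).indicator (1 : Ω → ℝ) ω := by
          intro k
          set T := rootQuantile Z I fit M r p n k ω with hT
          by_cases hmem : ω ∈ A k
          · rw [Set.indicator_of_mem hmem, Pi.one_apply, mul_one]
            -- Young's inequality `u ≤ ζ u² + 1 / (4 ζ)`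
            have y1 : |T - q| ≤ ζ * (T - q) ^ 2 + (4 * ζ)⁻¹ := by
              have e : ζ * (T - q) ^ 2 + (4 * ζ)⁻¹ - |T - q|
                  = (4 * ζ)⁻¹ * (2 * ζ * |T - q| - 1) ^ 2 := by
                rw [← sq_abs (T - q)]; field_simp; ring
              have : 0 ≤ (4 * ζ)⁻¹ * (2 * ζ * |T - q| - 1) ^ 2 := by positivity
              linarith
            have y2 : (T - q) ^ 2 ≤ 2 * T ^ 2 + 2 * q ^ 2 := by nlinarith [sq_nonneg (T + q)]
            nlinarith
          · rw [Set.indicator_of_notMem hmem, mul_zero, add_zero]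
            have : |T - q| < ε / 2 := not_le.1 hmem
            have : 0 ≤ ζ * (2 * T ^ 2 + 2 * q ^ 2) := by positivity
            linarith
        calc |(∑ k, rootQuantile Z I fit M r p n k ω) / s n - q|
            ≤ (∑ k, |rootQuantile Z I fit M r p n k ω - q|) / s n := by
              rw [e0, abs_div, abs_of_pos hsn']
              gcongr
              exact Finset.abs_sum_le_sum_abs _ _
          _ ≤ (∑ k, (ε / 2 + ζ * (2 * rootQuantile Z I fit M r p n k ω ^ 2 + 2 * q ^ 2)
              + (4 * ζ)⁻¹ * (A k).indicator (1 : Ω → ℝ) ω)) / s n := by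
              gcongr with k _
              exact hk k
          _ = ε / 2 + ζ * (2 * ((∑ k, rootQuantile Z I fit M r p n k ω ^ 2) / s n) + 2 * q ^ 2)
              + (4 * ζ)⁻¹ * ((∑ k, (A k).indicator (1 : Ω → ℝ) ω) / s n) := by
              simp only [Finset.sum_add_distrib, ← Finset.mul_sum, Finset.sum_const,
                Finset.card_univ, Fintype.card_fin, nsmul_eq_mul]
              field_simp
          _ < ε / 2 + ζ * (2 * K + 2 * q ^ 2) + (4 * ζ)⁻¹ * (ε * ζ) := by gcongr
          _ = ε := by rw [hζK]; field_simp; ring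
    _ ≤ ENNReal.ofReal (η / 2) + ENNReal.ofReal (η / 2) :=
        (measure_union_le _ _).trans (add_le_add h1 (h2 ()))
    _ = ENNReal.ofReal η := by
        rw [← ENNReal.ofReal_add (by positivity) (by positivity), add_halves]

omit [MeasurableSpace Ω] [MeasurableSpace 𝒵] in
lemma sqrt_mul_avgQuantile_sub {r : ℕ → ℕ} {p : ℝ} (hp : p ∈ Set.Ioo (0 : ℝ) 1) {n : ℕ}
    (hn : 0 < n) (hr : 0 < r n) (ω : Ω) (c : ℝ) :
    √(n : ℝ) * (avgQuantile Z I fit M r p n ω - c)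
      = (∑ k, rootQuantile Z I fit M r p n k ω) / s n
        + √(n : ℝ) * ((∑ k : Fin (s n), empMean (contrib Z I fit n k ω)) / s n - c) := by
  have hn' : 0 < √(n : ℝ) := Real.sqrt_pos.2 (by exact_mod_cast hn)
  have h : ∀ k, rootQuantile Z I fit M r p n k ω
      = √(n : ℝ) * ((empQuantile p fun l : Fin (r n) => bootReplicate Z I fit M n k l ω)
        - empMean (contrib Z I fit n k ω)) := fun k =>
    empQuantile_affine hp hr (fun l : Fin (r n) => bootReplicate Z I fit M n k l ω) hn'
      (empMean (contrib Z I fit n k ω))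
  simp only [h, avgQuantile]
  rw [← Finset.mul_sum, Finset.sum_sub_distrib]
  ring

omit [IsProbabilityMeasure μ] in
lemma tendstoInMeasure_add_const {f g : ℕ → Ω → ℝ} {c d : ℝ}
    (hf : TendstoInMeasure μ f atTop fun _ => c) (hg : TendstoInMeasure μ g atTop fun _ => d) :
    TendstoInMeasure μ (fun n ω => f n ω + g n ω) atTop fun _ => c + d := by
  rw [tendstoInMeasure_const_iff] at *
  intro ε hε
  refine ((hf _ (half_pos hε)).union (hg _ (half_pos hε))).mono
    (Eventually.of_forall fun n _ ω hω => ?_)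
  by_contra hcon
  simp only [Set.mem_union, Set.mem_ofPred_eq, not_or, not_le] at hcon
  have hω' : ε ≤ |f n ω + g n ω - (c + d)| := hω
  have h1 : f n ω + g n ω - (c + d) = (f n ω - c) + (g n ω - d) := by ring
  rw [h1] at hω'
  linarith [abs_add_le (f n ω - c) (g n ω - d)]

lemma quantileTargets (hS : IsSubsampling μ Z I) (hψ : IsInfluence μ Z ψ)
    (hfit : ∀ n, Measurable (fit n)) (hR : IsResampling μ Z I M) (hs : ∀ᶠ n in atTop, 0 < s n)
    (h_rem_sq : SubsetLittleOp μ s fun (n : ℕ) k ω =>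
      (∑ a, remainder Z I fit θ₀ ψ n k ω a ^ 2) / b n)
    (h_avg : TendstoInMeasure μ (fun n ω => (∑ k : Fin (s n),
        (∑ a, remainder Z I fit θ₀ ψ n k ω a ^ 2) / b n) / s n) atTop (fun _ => (0 : ℝ)))
    {full : (n : ℕ) → (Fin n → 𝒵) → ℝ}
    {r : ℕ → ℕ} (hr : Tendsto r atTop atTop) (hV : 0 < Var[ψ; μ.map (Z 0)])
    (h_mean : TendstoInMeasure μ
      (fun (n : ℕ) ω => √(n : ℝ) *
        ((∑ k : Fin (s n), empMean (contrib Z I fit n k ω)) / s n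
          - full n fun i => Z i ω)) atTop (fun _ => (0 : ℝ)))
    {p : ℝ} (hp : p ∈ Set.Ioo (0 : ℝ) 1) :
    QuantileTargets μ Z I fit M r full Var[ψ; μ.map (Z 0)] p := by
  intro q hq
  have h := tendstoInMeasure_add_const
    (tendstoInMeasure_average_rootQuantile hS hψ hfit hR hs h_rem_sq h_avg hr hV hp hq) h_mean
  rw [add_zero] at h
  refine h.congr' ?_ (ae_eq_refl _)
  filter_upwards [eventually_gt_atTop 0, hr.eventually_gt_atTop 0] with n hn hrn
  exact ae_of_all _ fun ω => (sqrt_mul_avgQuantile_sub hp hn hrn ω _).symm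

end Averages

/-! ### Coverage of the percentile interval -/

lemma cdf_gaussianReal_neg {v : ℝ≥0} (hv : v ≠ 0) (x : ℝ) :
    cdf (gaussianReal 0 v) (-x) = 1 - cdf (gaussianReal 0 v) x := by
  have := nullSingletonClass_gaussianReal (μ := 0) hv
  have hneg : (gaussianReal 0 v).map (fun t => -t) = gaussianReal 0 v := by
    rw [gaussianReal_map_neg, neg_zero]
  rw [cdf_eq_real, cdf_eq_real]
  nth_rewrite 1 [← hneg]
  rw [map_measureReal_apply measurable_neg measurableSet_Iic]
  have h1 : (fun t : ℝ => -t) ⁻¹' Set.Iic (-x) = Set.Ici x := by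
    ext t; simp
  rw [h1, ← measureReal_congr Ioi_ae_eq_Ici, ← Set.compl_Iic, probReal_compl_eq_one_sub
    measurableSet_Iic]

section Coverage

variable {Ω 𝒵 : Type*} [MeasurableSpace Ω] [MeasurableSpace 𝒵] {μ : Measure Ω}
  [IsProbabilityMeasure μ] {Z : ℕ → Ω → 𝒵} {s b : ℕ → ℕ}
  {I : (n : ℕ) → Ω → Fin (s n) → Fin (b n) → Fin n} {ψ : 𝒵 → ℝ}

/-- The central limit theorem for the sums of the influence values. -/
lemma tendsto_measureReal_sum_influence_le (hS : IsSubsampling μ Z I) (hψ : IsInfluence μ Z ψ)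
    (hV : 0 < Var[ψ; μ.map (Z 0)]) (t : ℝ) :
    Tendsto (fun n : ℕ => μ.real {ω | (∑ i : Fin n, ψ (Z i ω)) / √(n : ℝ) ≤ t}) atTop
      (𝓝 (cdf (gaussianReal 0 Var[ψ; μ.map (Z 0)].toNNReal) t)) := by
  have hψm := hψ.measurable
  have hVn : Var[ψ; μ.map (Z 0)].toNNReal ≠ 0 := (Real.toNNReal_pos.2 hV).ne'
  have hvar : Var[fun ω => ψ (Z 0 ω); μ] = Var[ψ; μ.map (Z 0)] := by
    rw [variance_map hψm.aemeasurable (hS.measurable_sample 0).aemeasurable]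
    rfl
  have hclt := tendstoInDistribution_inv_sqrt_mul_sum_sub (P := μ) (X := fun i ω => ψ (Z i ω))
    (Y := id) (P' := gaussianReal 0 Var[fun ω => ψ (Z 0 ω); μ].toNNReal) HasLaw.id
    (hψ.memLp_comp hS) (hS.indep.comp (fun _ z => ψ z) fun _ => by fun_prop)
    (fun i => (hS.ident i).comp (u := fun z => ψ z) (by fun_prop))
  have hatoms := nullSingletonClass_gaussianReal (μ := 0) hVn
  have h := ProbabilityMeasure.tendsto_measure_of_null_frontier_of_tendsto' hclt.tendsto
    (E := Set.Iic t) (by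
      rw [frontier_Iic]
      simp only [ProbabilityMeasure.coe_mk, Measure.map_id, hvar]
      exact measure_singleton t)
  simp only [ProbabilityMeasure.coe_mk, Measure.map_id, hvar] at h
  rw [cdf_eq_real]
  refine ((ENNReal.tendsto_toReal (measure_ne_top _ _)).comp h).congr fun n => ?_
  rw [Function.comp_apply, Measure.map_apply_of_aemeasurable (hclt.forall_aemeasurable n)
    measurableSet_Iic, measureReal_def]
  congr 2
  ext ω
  rw [Set.mem_preimage, Set.mem_Iic, hψ.integral_comp hS, mul_zero, sub_zero,
    ← Fin.sum_univ_eq_sum_range (fun i => ψ (Z i ω)), inv_mul_eq_div]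
  rfl

/-- If the end points of an interval, centred and scaled, are asymptotically the sum of two
constants and of a common statistic with a continuous limiting distribution function `Φ`, then the
coverage probability of the interval converges. No measurability of the end points is needed. -/
lemma tendsto_coverage {W L H : ℕ → Ω → ℝ} {Φ : ℝ → ℝ} (hΦ : Continuous Φ)
    (hWm : ∀ n, Measurable (W n))
    (hW : ∀ t, Tendsto (fun n => μ.real {ω | W n ω ≤ t}) atTop (𝓝 (Φ t))) {ql qh : ℝ}
    (hq : ql ≤ qh) (hL : TendstoInMeasure μ (fun n ω => L n ω - W n ω) atTop fun _ => ql)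
    (hH : TendstoInMeasure μ (fun n ω => H n ω - W n ω) atTop fun _ => qh) :
    Tendsto (fun n => μ.real {ω | L n ω < 0 ∧ 0 < H n ω}) atTop (𝓝 (Φ (-ql) - Φ (-qh))) := by
  have hbad (ε : ℝ) (hε : 0 < ε) : Tendsto (fun n => μ.real {ω | ε ≤ ‖L n ω - W n ω - ql‖}
      + μ.real {ω | ε ≤ ‖H n ω - W n ω - qh‖}) atTop (𝓝 0) := by
    simpa using (tendstoInMeasure_iff_measureReal_norm.1 hL ε hε).add
      (tendstoInMeasure_iff_measureReal_norm.1 hH ε hε)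
  have hWms (n) (t : ℝ) : MeasurableSet {ω | W n ω ≤ t} :=
    measurableSet_le (hWm n) measurable_const
  have hcu : Tendsto (fun ε => Φ (-ql + ε) - Φ (-qh - ε)) (𝓝[>] 0) (𝓝 (Φ (-ql) - Φ (-qh))) := by
    have : Continuous fun ε => Φ (-ql + ε) - Φ (-qh - ε) := by fun_prop
    simpa using (this.tendsto 0).mono_left nhdsWithin_le_nhds
  have hcl : Tendsto (fun ε => Φ (-ql - ε) - Φ (-qh + ε)) (𝓝[>] 0) (𝓝 (Φ (-ql) - Φ (-qh))) := by
    have : Continuous fun ε => Φ (-ql - ε) - Φ (-qh + ε) := by fun_prop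
    simpa using (this.tendsto 0).mono_left nhdsWithin_le_nhds
  refine tendsto_order.2 ⟨fun c hc => ?_, fun c hc => ?_⟩
  · obtain ⟨ε, hε1, hε⟩ := ((hcl.eventually_const_lt hc).and self_mem_nhdsWithin).exists
    have hε0 : 0 < ε := hε
    have hlim := ((hW (-ql - ε)).sub (hW (-qh + ε))).sub (hbad ε hε0)
    rw [sub_zero] at hlim
    filter_upwards [hlim.eventually_const_lt hε1] with n hn
    refine hn.trans_le ?_
    have hsub : {ω | W n ω ≤ -ql - ε} ⊆ {ω | L n ω < 0 ∧ 0 < H n ω} ∪ {ω | W n ω ≤ -qh + ε}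
        ∪ ({ω | ε ≤ ‖L n ω - W n ω - ql‖} ∪ {ω | ε ≤ ‖H n ω - W n ω - qh‖}) := by
      intro ω hω
      by_contra hcon
      simp only [Set.mem_union, Set.mem_ofPred_eq, not_or, not_le, Real.norm_eq_abs] at hcon hω
      obtain ⟨⟨h1, h2⟩, h3, h4⟩ := hcon
      exact h1 ⟨by linarith [(abs_lt.1 h3).2], by linarith [(abs_lt.1 h4).1]⟩
    have h1 := measureReal_mono (μ := μ) hsub
    have h2 := measureReal_union_le (μ := μ)
      ({ω | L n ω < 0 ∧ 0 < H n ω} ∪ {ω | W n ω ≤ -qh + ε})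
      ({ω | ε ≤ ‖L n ω - W n ω - ql‖} ∪ {ω | ε ≤ ‖H n ω - W n ω - qh‖})
    have h3 := measureReal_union_le (μ := μ)
      {ω | L n ω < 0 ∧ 0 < H n ω} {ω | W n ω ≤ -qh + ε}
    have h4 := measureReal_union_le (μ := μ)
      {ω | ε ≤ ‖L n ω - W n ω - ql‖} {ω | ε ≤ ‖H n ω - W n ω - qh‖}
    linarith
  · obtain ⟨ε, hε1, hε⟩ := ((hcu.eventually_lt_const hc).and self_mem_nhdsWithin).exists
    have hε0 : 0 < ε := hε
    have hlim := ((hW (-ql + ε)).sub (hW (-qh - ε))).add (hbad ε hε0)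
    rw [add_zero] at hlim
    filter_upwards [hlim.eventually_lt_const hε1] with n hn
    refine lt_of_le_of_lt ?_ hn
    have hsub : {ω | L n ω < 0 ∧ 0 < H n ω} ⊆ ({ω | W n ω ≤ -ql + ε} \ {ω | W n ω ≤ -qh - ε})
        ∪ ({ω | ε ≤ ‖L n ω - W n ω - ql‖} ∪ {ω | ε ≤ ‖H n ω - W n ω - qh‖}) := by
      intro ω hω
      by_contra hcon
      simp only [Set.mem_union, Set.mem_ofPred_eq, not_or, not_le, Real.norm_eq_abs,
        Set.mem_sdiff] at hcon hω
      obtain ⟨h1, h3, h4⟩ := hcon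
      exact h1 ⟨by linarith [(abs_lt.1 h3).1], by linarith [(abs_lt.1 h4).2]⟩
    have hdiff : μ.real ({ω | W n ω ≤ -ql + ε} \ {ω | W n ω ≤ -qh - ε})
        = μ.real {ω | W n ω ≤ -ql + ε} - μ.real {ω | W n ω ≤ -qh - ε} :=
      measureReal_sdiff (fun ω hω => le_trans (show W n ω ≤ -qh - ε from hω) (by linarith))
        (hWms n _)
    have h1 := measureReal_mono (μ := μ) hsub
    have h2 := measureReal_union_le (μ := μ)
      ({ω | W n ω ≤ -ql + ε} \ {ω | W n ω ≤ -qh - ε})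
      ({ω | ε ≤ ‖L n ω - W n ω - ql‖} ∪ {ω | ε ≤ ‖H n ω - W n ω - qh‖})
    have h4 := measureReal_union_le (μ := μ)
      {ω | ε ≤ ‖L n ω - W n ω - ql‖} {ω | ε ≤ ‖H n ω - W n ω - qh‖}
    linarith

/-- If the averaged quantiles target those of `N(0, V)`, then both end points are asymptotically
linear in the influence values, and the symmetry of `N(0, V)` gives the level `1 - α`. -/
lemma tendsto_coverage_avgQuantile (hS : IsSubsampling μ Z I) (hψ : IsInfluence μ Z ψ)
    {fit : (n : ℕ) → (Fin (b n) → 𝒵) → Fin (b n) → ℝ}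
    {M : (n : ℕ) → Fin (s n) → ℕ → Ω → Fin (b n) → ℕ}
    {full : (n : ℕ) → (Fin n → 𝒵) → ℝ} {θ₀ : ℝ}
    (h_full : TendstoInMeasure μ
      (fun (n : ℕ) ω => √(n : ℝ) * (full n (fun i => Z i ω) - θ₀)
        - (∑ i : Fin n, ψ (Z i ω)) / √(n : ℝ)) atTop (fun _ => (0 : ℝ)))
    {r : ℕ → ℕ} {α : ℝ} (hα : α ∈ Set.Ioo (0 : ℝ) 1) (hV : 0 < Var[ψ; μ.map (Z 0)])
    (h_lo : QuantileTargets μ Z I fit M r full Var[ψ; μ.map (Z 0)] (α / 2))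
    (h_hi : QuantileTargets μ Z I fit M r full Var[ψ; μ.map (Z 0)] (1 - α / 2)) :
    Tendsto (fun n => μ.real {ω | θ₀ ∈ Set.Ioo (avgQuantile Z I fit M r (α / 2) n ω)
      (avgQuantile Z I fit M r (1 - α / 2) n ω)}) atTop (𝓝 (1 - α)) := by
  have hψm := hψ.measurable
  have hVn : Var[ψ; μ.map (Z 0)].toNNReal ≠ 0 := (Real.toNNReal_pos.2 hV).ne'
  obtain ⟨ql, hql⟩ := exists_cdf_gaussianReal_eq hVn (p := α / 2)
    ⟨by linarith [hα.1], by linarith [hα.2]⟩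
  obtain ⟨qh, hqh⟩ := exists_cdf_gaussianReal_eq hVn (p := 1 - α / 2)
    ⟨by linarith [hα.2], by linarith [hα.1]⟩
  have hq : ql ≤ qh := by
    refine ((strictMono_cdf_gaussianReal hVn).le_iff_le).1 ?_
    rw [hql, hqh]
    linarith [hα.2]
  have hsum (p q : ℝ) (h : TendstoInMeasure μ (fun (n : ℕ) ω =>
        √(n : ℝ) * (avgQuantile Z I fit M r p n ω - full n fun i => Z i ω)) atTop fun _ => q) :
      TendstoInMeasure μ (fun (n : ℕ) ω => √(n : ℝ) * (avgQuantile Z I fit M r p n ω - θ₀)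
        - (∑ i : Fin n, ψ (Z i ω)) / √(n : ℝ)) atTop fun _ => q := by
    have h' := tendstoInMeasure_add_const h h_full
    rw [add_zero] at h'
    refine h'.congr_left fun n => ae_of_all _ fun ω => ?_
    ring
  have hcov := tendsto_coverage (μ := μ) (continuous_cdf_gaussianReal hVn)
    (fun n => by have := hS.measurable_sample; fun_prop)
    (tendsto_measureReal_sum_influence_le hS hψ hV) hq
    (hsum _ _ (h_lo ql hql)) (hsum _ _ (h_hi qh hqh))
  rw [cdf_gaussianReal_neg hVn, cdf_gaussianReal_neg hVn, hql, hqh,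
    show 1 - α / 2 - (1 - (1 - α / 2)) = 1 - α by ring] at hcov
  refine hcov.congr' ?_
  filter_upwards [eventually_gt_atTop 0] with n hn
  have hn' : 0 < √(n : ℝ) := Real.sqrt_pos.2 (by exact_mod_cast hn)
  have hneg (x : ℝ) : √(n : ℝ) * x < 0 ↔ x < 0 :=
    ⟨fun h => by_contra fun hx => h.not_ge (mul_nonneg hn'.le (not_lt.1 hx)),
      mul_neg_of_pos_of_neg hn'⟩
  congr 1
  ext ω
  simp only [Set.mem_ofPred_eq, Set.mem_Ioo, hneg, sub_neg,
    mul_pos_iff_of_pos_left hn', sub_pos]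

end Coverage

end CBLB

theorem theorem1 {Ω 𝒵 : Type*} [MeasurableSpace Ω] [MeasurableSpace 𝒵]
    (μ : Measure Ω) [IsProbabilityMeasure μ]
    -- i.i.d. observations; the sample of size `n` is `Z 0, …, Z (n - 1)`
    (Z : ℕ → Ω → 𝒵) (hZ : ∀ i, Measurable (Z i))
    (hZ_indep : iIndepFun Z μ) (hZ_ident : ∀ i, IdentDistrib (Z i) (Z 0) μ μ)
    -- `s n` disjoint subsets of size `b n`, drawn independently of the data
    (s b : ℕ → ℕ) (hb_pos : ∀ n, 0 < b n)
    (I : (n : ℕ) → Ω → Fin (s n) → Fin (b n) → Fin n) (hI : ∀ n, Measurable (I n))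
    (hI_disj : ∀ n ω, Function.Injective fun p : Fin (s n) × Fin (b n) => I n ω p.1 p.2)
    (hI_indep : ∀ n, IndepFun (fun ω i => Z i ω) (I n) μ)
    -- the fitting procedure, run once on each subset
    (fit : (n : ℕ) → (Fin (b n) → 𝒵) → Fin (b n) → ℝ) (hfit : ∀ n, Measurable (fit n))
    -- multinomial counts: independent over subsets and replicates, independent of the data
    (M : (n : ℕ) → Fin (s n) → ℕ → Ω → Fin (b n) → ℕ)
    (hM : ∀ n k l, HasLaw (M n k l)
      (CBLB.multinomialLaw n fun _ : Fin (b n) => (b n : ℝ≥0∞)⁻¹) μ)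
    (hM_indep : ∀ n, iIndepFun (fun (kl : Fin (s n) × ℕ) => M n kl.1 kl.2) μ)
    (hM_data : ∀ n, IndepFun (fun ω => ((fun i => Z i ω), I n ω))
      (fun ω (kl : Fin (s n) × ℕ) => M n kl.1 kl.2 ω) μ)
    -- (i) the full-sample estimator has influence function `ψ`
    (θ₀ : ℝ) (ψ : 𝒵 → ℝ) (hψ : Measurable ψ) (hψ_L2 : MemLp ψ 2 (μ.map (Z 0)))
    (hψ_mean : ∫ z, ψ z ∂(μ.map (Z 0)) = 0)
    (full : (n : ℕ) → (Fin n → 𝒵) → ℝ)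
    (h_full : TendstoInMeasure μ
      (fun (n : ℕ) ω => √(n : ℝ) * (full n (fun i => Z i ω) - θ₀)
        - (∑ i : Fin n, ψ (Z i ω)) / √(n : ℝ)) atTop (fun _ => (0 : ℝ)))
    -- (ii) first-order approximation of the contributions within a subset
    (h_rem : CBLB.SubsetLittleOp μ s fun (n : ℕ) k ω =>
      (∑ a, CBLB.remainder Z I fit θ₀ ψ n k ω a) / √(b n : ℝ))
    (h_rem_sq : CBLB.SubsetLittleOp μ s fun (n : ℕ) k ω =>
      (∑ a, CBLB.remainder Z I fit θ₀ ψ n k ω a ^ 2) / b n)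
    -- (iii) `b → ∞`, `b / n → 0`, and all but `o(n)` observations are covered
    (hb : Tendsto b atTop atTop)
    (hbn : Tendsto (fun n => (b n : ℝ) / n) atTop (𝓝 0))
    (h_cover : (fun n : ℕ => (n : ℝ) - s n * b n) =o[atTop] fun n : ℕ => (n : ℝ)) :
    -- conditionally on the data of the subset, the centred and scaled replicate is asymptotically
    -- `N(0, σ_k²)`, weak convergence being measured by the Lévy–Prokhorov distance
    (∀ l : ℕ, CBLB.SubsetLittleOp μ s fun (n : ℕ) k ω =>
      levyProkhorovDist
        (condDistrib
          (fun ω' => √(n : ℝ) * (CBLB.bootReplicate Z I fit M n k l ω'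
            - CBLB.empMean (CBLB.contrib Z I fit n k ω')))
          (CBLB.subsetData Z I n k) μ (CBLB.subsetData Z I n k ω))
        (gaussianReal 0 (CBLB.empVar (CBLB.contrib Z I fit n k ω)).toNNReal)) ∧
    -- the proportion of subsets with `σ_k²` away from `Var ψ(Z)` vanishes
    (∀ ε : ℝ, 0 < ε → TendstoInMeasure μ
      (fun n ω => ((Finset.univ.filter fun k : Fin (s n) =>
          ε < |CBLB.empVar (CBLB.contrib Z I fit n k ω) - Var[ψ; μ.map (Z 0)]|).card : ℝ) / s n)
      atTop (fun _ => (0 : ℝ))) ∧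
    -- when the mean squared remainders are negligible also on average over the subsets:
    (TendstoInMeasure μ
      (fun n ω => (∑ k : Fin (s n),
        (∑ a, CBLB.remainder Z I fit θ₀ ψ n k ω a ^ 2) / b n) / s n) atTop (fun _ => (0 : ℝ)) →
      -- the average of the `σ_k²` converges to `Var ψ(Z)`
      TendstoInMeasure μ
        (fun n ω => (∑ k : Fin (s n), CBLB.empVar (CBLB.contrib Z I fit n k ω)) / s n)
        atTop (fun _ => Var[ψ; μ.map (Z 0)]) ∧
      -- and the averaged bootstrap quantiles target those of the limit law, if moreover the
      -- number of replicates diverges and the averaged subset estimator agrees to first order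
      -- with the full-sample estimator
      (∀ r : ℕ → ℕ, Tendsto r atTop atTop → 0 < Var[ψ; μ.map (Z 0)] →
        TendstoInMeasure μ
          (fun (n : ℕ) ω => √(n : ℝ) *
            ((∑ k : Fin (s n), CBLB.empMean (CBLB.contrib Z I fit n k ω)) / s n
              - full n fun i => Z i ω)) atTop (fun _ => (0 : ℝ)) →
        ∀ p ∈ Set.Ioo (0 : ℝ) 1,
          CBLB.QuantileTargets μ Z I fit M r full Var[ψ; μ.map (Z 0)] p)) ∧
    -- whenever the averaged quantiles at both levels target those of the limit law, the cBLB
    -- percentile intervals have asymptotically correct coverage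
    (∀ (r : ℕ → ℕ) (α : ℝ), α ∈ Set.Ioo (0 : ℝ) 1 → 0 < Var[ψ; μ.map (Z 0)] →
      CBLB.QuantileTargets μ Z I fit M r full Var[ψ; μ.map (Z 0)] (α / 2) →
      CBLB.QuantileTargets μ Z I fit M r full Var[ψ; μ.map (Z 0)] (1 - α / 2) →
      Tendsto (fun n => μ.real {ω | θ₀ ∈ Set.Ioo (CBLB.avgQuantile Z I fit M r (α / 2) n ω)
          (CBLB.avgQuantile Z I fit M r (1 - α / 2) n ω)}) atTop (𝓝 (1 - α))) := by
  have hS : CBLB.IsSubsampling μ Z I :=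
    ⟨hZ, hZ_indep, hZ_ident, hI, hI_disj, hI_indep, hb_pos, hb⟩
  have hψ' : CBLB.IsInfluence μ Z ψ := ⟨hψ, hψ_L2, hψ_mean⟩
  have hR : CBLB.IsResampling μ Z I M := ⟨hM, hM_indep, hM_data⟩
  have hs : ∀ᶠ n in atTop, 0 < s n := by
    filter_upwards [h_cover.def (by norm_num : (0 : ℝ) < 1 / 2), eventually_gt_atTop 0]
      with n hn hn0
    refine Nat.pos_of_ne_zero fun h0 => ?_
    have : (0 : ℝ) < n := by exact_mod_cast hn0
    rw [h0, Nat.cast_zero, zero_mul, sub_zero, Real.norm_of_nonneg this.le] at hn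
    linarith
  exact ⟨fun l => CBLB.tendsto_levyProkhorovDist_replicate hS hψ' hfit hR h_rem_sq l,
    fun ε hε => CBLB.tendstoInMeasure_card_empVar hS hψ' hfit h_rem_sq hε,
    fun h_avg => ⟨CBLB.tendstoInMeasure_average_empVar hS hψ' hs h_avg,
      fun r hr hV h_mean p hp =>
        CBLB.quantileTargets hS hψ' hfit hR hs h_rem_sq h_avg hr hV h_mean hp⟩,
    fun r α hα hV h_lo h_hi =>
      CBLB.tendsto_coverage_avgQuantile hS hψ' h_full hα hV h_lo h_hi⟩
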